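/- **Conventions.** Let $\mathfrak S_n$ be the set of permutations of $[n]=\{1,\dots,n\}$, written in one-line notation. A permutation $\sigma\in\mathfrak S_n$ contains $\pi\in\mathfrak S_k$ as a pattern if some subsequence of $\sigma$ has the same relative order as $\pi$. For a set $\Pi$ of permutations (possibly of different lengths), $\mathfrak S_n(\Pi)$ is the set of $\sigma\in\mathfrak S_n$ containing no $\pi\in\Pi$. Let $\operatorname{Des}\sigma=\{i\mid \sigma_i>\sigma_{i+1}\}\subseteq[n-1]$, and for $S\subseteq[n-1]$ let $$F_S=\sum x_{i_1}x_{i_2}\cdots x_{i_n}$$ be the fundamental quasisymmetric function of degree $n$ in variables $x_1,x_2,\dots$, where the sum is over $i_1\le i_2\le\dots\le i_n$ with $i_j<i_{j+1}$ whenever $j\in S$. Put $$Q_n(\Pi)=\sum_{\sigma\in\mathfrak S_n(\Pi)}F_{\operatorname{Des}\sigma}.$$ Let $P(\pi)$ be the insertion tableau of $\pi$ under the Robinson–Schensted correspondence. A Knuth class is a set of the form $K(P)=\{\pi\mid P(\pi)=P\}$, and for a partition $\lambda$ let $K(\lambda)=\{\pi\mid P(\pi)\text{ has shape }\lambda\}$.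 Call $\Pi$ pattern-Knuth closed if $\mathfrak S_k(\Pi)$ is a union of Knuth classes for every $k\ge 0$. Let $s_\lambda$ be the Schur function and $f^\lambda$ the number of standard Young tableaux of shape $\lambda$; containment $\lambda\supseteq\mu$ of partitions means containment of Young diagrams. **Theorem.** Let $a\ge 2$ and $b\ge 1$ be integers, $\mu=(a,1^b)$, $\tau=(a,2,1^{b-1})$ and $\Pi=K(\mu)\cup K(\tau)$. Then $\Pi$ is pattern-Knuth closed, and for every $n\ge 0$ $$Q_n(\Pi)=\sum_{\substack{\lambda\vdash n\\ \lambda\not\supseteq\mu}} f^\lambda s_\lambda .$$ -/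

import Mathlib

/-- `σ` contains `π` as a pattern: some subsequence of the one-line word of `σ` (at the positions
given by the strictly increasing map `f`) has the same relative order as `π`. Permutations of
`[n]` are `Equiv.Perm (Fin n)`, with one-line word `σ 0, σ 1, …`. -/
def ContainsPattern {n k : ℕ} (σ : Equiv.Perm (Fin n)) (π : Equiv.Perm (Fin k)) : Prop :=
  ∃ f : Fin k ↪o Fin n, ∀ i j : Fin k, σ (f i) < σ (f j) ↔ π i < π j

/-- The set of permutations of `[n]` avoiding every pattern in `Pat`; the patterns may have
different lengths. -/
def avoiders (n : ℕ) (Pat : Set (Σ k : ℕ, Equiv.Perm (Fin k))) : Set (Equiv.Perm (Fin n)) :=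
  {σ | ∀ π ∈ Pat, ¬ ContainsPattern σ π.2}

/-- The descent set `{i | σ_i > σ_{i+1}} ⊆ [n-1]`, with positions counted from `1`. -/
def descentSet {n : ℕ} (σ : Equiv.Perm (Fin n)) : Set ℕ :=
  {j | ∃ (i : ℕ) (h : i + 1 < n), j = i + 1 ∧ σ ⟨i + 1, h⟩ < σ ⟨i, Nat.lt_of_succ_lt h⟩}

/-- The fundamental quasisymmetric function `F_S` of degree `n`, for `S ⊆ [n-1]`, as a formal power
series in the variables indexed by `ℕ`: the coefficient of a monomial `m` is the number of
sequences of indices `x_1 ≤ x_2 ≤ ⋯ ≤ x_n` with `x_j < x_{j+1}` for `j ∈ S` whose product of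
variables is `m`. -/
noncomputable def fundamentalQSym (n : ℕ) (S : Set ℕ) : MvPowerSeries ℕ ℝ :=
  fun m => (Nat.card {x : Fin n → ℕ // Monotone x ∧
    (∀ (i : ℕ) (h : i + 1 < n), i + 1 ∈ S → x ⟨i, Nat.lt_of_succ_lt h⟩ < x ⟨i + 1, h⟩) ∧
    ∑ i, Finsupp.single (x i) 1 = m} : ℝ)

open scoped Classical in
/-- `Q_n(Pat)`, the sum of `F_{Des σ}` over the permutations `σ` of `[n]` that avoid `Pat`. -/
noncomputable def patternQSym (n : ℕ) (Pat : Set (Σ k : ℕ, Equiv.Perm (Fin k))) :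
    MvPowerSeries ℕ ℝ :=
  ∑ σ : Equiv.Perm (Fin n) with σ ∈ avoiders n Pat, fundamentalQSym n (descentSet σ)

/-- The Schur function `s_lam`: the coefficient of a monomial `m` is the number of semistandard
Young tableaux of shape `lam` in which each `k` occurs exactly `m k` times. -/
noncomputable def schurFunction (lam : YoungDiagram) : MvPowerSeries ℕ ℝ :=
  fun m => (Nat.card {T : SemistandardYoungTableau lam //
    ∀ k : ℕ, (lam.cells.filter fun c => T c.1 c.2 = k).card = m k} : ℝ)

/-- Standard Young tableaux of shape `lam`: bijective fillings of the cells with `lam.card`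
consecutive numbers, increasing along rows and down columns. -/
def StandardTableau (lam : YoungDiagram) : Type :=
  {T : lam.cells ≃ Fin lam.card //
    (∀ c d : lam.cells, c.1.1 = d.1.1 → c.1.2 < d.1.2 → T c < T d) ∧
    (∀ c d : lam.cells, c.1.2 = d.1.2 → c.1.1 < d.1.1 → T c < T d)}

/-- `f^lam`, the number of standard Young tableaux of shape `lam`. -/
noncomputable def numSYT (lam : YoungDiagram) : ℕ := Nat.card (StandardTableau lam)

/-- Insert `x` into a row: `x` replaces the leftmost entry larger than `x`, which is bumped, or is
put at the end if there is no such entry. -/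
def rowInsert (x : ℕ) : List ℕ → List ℕ × Option ℕ
  | [] => ([x], none)
  | y :: r => if x < y then (x :: r, some y) else (y :: (rowInsert x r).1, (rowInsert x r).2)

/-- Robinson–Schensted insertion of `x` into a tableau, given as the list of its rows from top to
bottom: an entry bumped from one row is inserted into the next. -/
def tableauInsert (x : ℕ) : List (List ℕ) → List (List ℕ)
  | [] => [[x]]
  | r :: T =>
    match (rowInsert x r).2 with
    | none => (rowInsert x r).1 :: T
    | some y => (rowInsert x r).1 :: tableauInsert y T

/-- The Robinson–Schensted `P`-tableau of `σ`, obtained by inserting its one-line word (with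
letters `1, …, n`) from left to right. -/
def pTableau {n : ℕ} (σ : Equiv.Perm (Fin n)) : List (List ℕ) :=
  (List.ofFn fun i : Fin n => (σ i : ℕ) + 1).foldl (fun T x => tableauInsert x T) []

/-- The Knuth class (within the permutations of `[n]`) of the tableau `P`. -/
def knuthClass (n : ℕ) (P : List (List ℕ)) : Set (Equiv.Perm (Fin n)) :=
  {σ | pTableau σ = P}

/-- `K(mu)`: all permutations whose `P`-tableau has shape `mu`. -/
def shapeClass (mu : YoungDiagram) : Set (Σ k : ℕ, Equiv.Perm (Fin k)) :=
  {π | (pTableau π.2).map List.length = mu.rowLens}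

/-- `Pat` is pattern-Knuth closed: for every `k`, the set of permutations of `[k]` avoiding `Pat`
is a union of Knuth classes. -/
def IsPatternKnuthClosed (Pat : Set (Σ k : ℕ, Equiv.Perm (Fin k))) : Prop :=
  ∀ k : ℕ, ∃ 𝒯 : Set (List (List ℕ)), avoiders k Pat = ⋃ P ∈ 𝒯, knuthClass k P

/-- The partition `(a, 1^b)`. -/
def hookShape (a b : ℕ) (ha : 2 ≤ a) : YoungDiagram :=
  YoungDiagram.ofRowLens (a :: List.replicate b 1) (by
    rw [List.sortedGE_iff_pairwise, List.pairwise_cons]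
    refine ⟨fun x hx => ?_, List.pairwise_replicate.2 (Or.inr le_rfl)⟩
    have := List.eq_of_mem_replicate hx
    omega)

/-- The partition `(a, 2, 1^(b-1))`, used for `b ≥ 1`. -/
def nearHookShape (a b : ℕ) (ha : 2 ≤ a) : YoungDiagram :=
  YoungDiagram.ofRowLens (a :: 2 :: List.replicate (b - 1) 1) (by
    rw [List.sortedGE_iff_pairwise, List.pairwise_cons, List.pairwise_cons]
    refine ⟨fun x hx => ?_, fun x hx => ?_, List.pairwise_replicate.2 (Or.inr le_rfl)⟩
    · rcases List.mem_cons.1 hx with h | h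
      · omega
      · have := List.eq_of_mem_replicate h
        omega
    · have := List.eq_of_mem_replicate hx
      omega)

theorem finite_youngDiagram_card (n : ℕ) : {lam : YoungDiagram | lam.card = n}.Finite := by
  refine Set.Finite.of_finite_image (f := YoungDiagram.cells)
    ((Finset.finite_toSet (Finset.range n ×ˢ Finset.range n).powerset).subset ?_)
    (fun x _ y _ h => YoungDiagram.ext h)
  rintro _ ⟨lam, hlam, rfl⟩
  rw [Finset.mem_coe, Finset.mem_powerset]
  rintro ⟨i, j⟩ hc
  have hc' : (i, j) ∈ lam := hc
  have h1 : lam.colLen j ≤ n := by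
    rw [YoungDiagram.colLen_eq_card, ← (show lam.card = n from hlam)]
    exact Finset.card_le_card (Finset.filter_subset _ _)
  have h2 : lam.rowLen i ≤ n := by
    rw [YoungDiagram.rowLen_eq_card, ← (show lam.card = n from hlam)]
    exact Finset.card_le_card (Finset.filter_subset _ _)
  rw [Finset.mem_product, Finset.mem_range, Finset.mem_range]
  exact ⟨(YoungDiagram.mem_iff_lt_colLen.1 hc').trans_le h1,
    (YoungDiagram.mem_iff_lt_rowLen.1 hc').trans_le h2⟩

/-- The finite set of partitions `lam ⊢ n`, as Young diagrams. -/
noncomputable def partitionsOf (n : ℕ) : Finset YoungDiagram :=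
  (finite_youngDiagram_card n).toFinset

open scoped Classical in
/-- The set of partitions `lam ⊢ n` with `lam ⊉ mu`. -/
noncomputable def shapesAvoiding (n : ℕ) (mu : YoungDiagram) : Finset YoungDiagram :=
  (partitionsOf n).filter fun lam => ¬ mu ≤ lam

/-! The theorem reduces to two facts. First, summing $F_{\operatorname{Des}\sigma}$ over all
$\sigma$ of shape $\lambda$ gives $f^\lambda s_\lambda$. Second, $\sigma$ avoids $\Pi$ exactly when
its shape does not contain $\mu$ (`mem_avoiders_iff`). The second fact also shows that avoidance
depends only on $P(\sigma)$, which is the Knuth closure.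

The first fact is RSK, read coefficient by coefficient (`sum_card_eq_numSYT_mul`). A sequence $x$
contributes to $F_{\operatorname{Des}\sigma}$ exactly when the two-line array with upper row $x$ and
lower row $\sigma$ is sorted lexicographically (`isBiword_biword_iff`). RSK sends such arrays
bijectively to pairs $(P,Q)$ of one shape, with $P=P(\sigma)$ standard and $Q$ semistandard with
content that of $x$ (`rsk_injOn`, `rsk_surjOn`). The bijection rests on reverse insertion and on the
row bumping lemma `Inserts.row_le_row_iff`.

For the second fact, a shape contains the hook $\mu$ iff its first row has at least $a$ cells and
its first column at least $b+1$. By Schensted's theorem this means that $\sigma$ has an increasing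
subsequence $I$ of length $a$ and a decreasing one $D$ of length $b+1$. Both are inherited from any
pattern, so containing a member of $\Pi$ forces the hook. Conversely, $I$ and $D$ share at most one
position. If they share one, the pattern on $I\cup D$ has size $a+b$ and a shape containing $\mu$,
hence equal to $\mu$. If they are disjoint, the pattern has size $a+b+1$. Either its first row and
column have exactly the lengths $a$ and $b+1$, so that the extra cell is at $(2,2)$ and the shape is
$\tau$, or one of them is longer. A longer one must meet its counterpart by pigeonhole, and dropping
a superfluous position returns to the first case (`HasHook.exists_pattern`).

Schensted's theorem is proved by checking that Knuth moves preserve lengths of monotone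
subsequences, and then reading these lengths off the reading word of the tableau. -/

/-! ### Tableaux as lists of rows, and row insertion as a relation. -/

/-- In counting form: the row `s`, placed below the row `r`, makes the columns strictly increasing. -/
def Dominates (r s : List ℕ) : Prop :=
  ∀ c, s.countP (· ≤ c) ≤ r.countP (· < c)

/-- Semistandard tableaux as lists of nonempty rows. -/
def IsTableau : List (List ℕ) → Prop
  | [] => True
  | r :: T => r ≠ [] ∧ r.Pairwise (· ≤ ·) ∧ Dominates r (T.headD []) ∧ IsTableau T

/-- `Inserts x T i T'`: row insertion of `x` into `T` gives `T'`, with the new cell in row `i`. -/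
inductive Inserts : ℕ → List (List ℕ) → ℕ → List (List ℕ) → Prop
  | nil (x : ℕ) : Inserts x [] 0 [[x]]
  | append {x : ℕ} {r : List ℕ} {T : List (List ℕ)} (h : ∀ e ∈ r, e ≤ x) :
      Inserts x (r :: T) 0 ((r ++ [x]) :: T)
  | bump {x y i : ℕ} {l s : List ℕ} {T T' : List (List ℕ)} (h : ∀ e ∈ l, e ≤ x) (hxy : x < y)
      (hT : Inserts y T i T') : Inserts x ((l ++ y :: s) :: T) (i + 1) ((l ++ x :: s) :: T')

/-- The row in which insertion of `x` creates a new cell. -/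
def insertionRow (x : ℕ) : List (List ℕ) → ℕ
  | [] => 0
  | r :: T =>
    match (rowInsert x r).2 with
    | none => 0
    | some y => insertionRow y T + 1

theorem rowInsert_of_forall_le {x : ℕ} {r : List ℕ} (h : ∀ e ∈ r, e ≤ x) :
    rowInsert x r = (r ++ [x], none) := by
  induction r with
  | nil => rfl
  | cons y r ih =>
    simp only [List.mem_cons, forall_eq_or_imp] at h
    simp [rowInsert, not_lt.2 h.1, ih h.2]

theorem rowInsert_of_lt {x y : ℕ} {l s : List ℕ} (h : ∀ e ∈ l, e ≤ x) (hxy : x < y) :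
    rowInsert x (l ++ y :: s) = (l ++ x :: s, some y) := by
  induction l with
  | nil => simp [rowInsert, hxy]
  | cons z l ih =>
    simp only [List.mem_cons, forall_eq_or_imp] at h
    simp [rowInsert, not_lt.2 h.1, ih h.2]

theorem forall_le_or_exists_split (x : ℕ) (r : List ℕ) :
    (∀ e ∈ r, e ≤ x) ∨ ∃ l y s, r = l ++ y :: s ∧ (∀ e ∈ l, e ≤ x) ∧ x < y := by
  induction r with
  | nil => simp
  | cons z r ih =>
    by_cases hz : x < z
    · exact Or.inr ⟨[], z, r, rfl, by simp, hz⟩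
    · rcases ih with h | ⟨l, y, s, rfl, hl, hy⟩
      · exact Or.inl (by simpa using ⟨not_lt.1 hz, h⟩)
      · exact Or.inr ⟨z :: l, y, s, rfl, by simpa using ⟨not_lt.1 hz, hl⟩, hy⟩

theorem inserts_tableauInsert (x : ℕ) (T : List (List ℕ)) :
    Inserts x T (insertionRow x T) (tableauInsert x T) := by
  induction T generalizing x with
  | nil => exact Inserts.nil x
  | cons r T ih =>
    rcases forall_le_or_exists_split x r with h | ⟨l, y, s, rfl, hl, hy⟩
    · simpa [insertionRow, tableauInsert, rowInsert_of_forall_le h] using Inserts.append h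
    · simpa [insertionRow, tableauInsert, rowInsert_of_lt hl hy] using Inserts.bump hl hy (ih y)

theorem Inserts.eq {x i : ℕ} {T T' : List (List ℕ)} (h : Inserts x T i T') :
    insertionRow x T = i ∧ tableauInsert x T = T' := by
  induction h with
  | nil x => exact ⟨rfl, rfl⟩
  | append h => simp [insertionRow, tableauInsert, rowInsert_of_forall_le h]
  | bump h hxy _ ih =>
    simp [insertionRow, tableauInsert, rowInsert_of_lt h hxy, ih.1, ih.2]

theorem Inserts.flatten_perm {x i : ℕ} {T T' : List (List ℕ)} (h : Inserts x T i T') :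
    T'.flatten.Perm (x :: T.flatten) := by
  induction h with
  | nil x => simp
  | @append x r T h => simp
  | @bump x y i l s T T' h hxy hT ih =>
    rw [List.perm_iff_count] at *
    intro a
    have := ih a
    simp only [List.flatten_cons, List.count_append, List.count_cons] at this ⊢
    omega

/-- Add a cell at the end of the `i`-th part of a composition. -/
def addCell : ℕ → List ℕ → List ℕ
  | _, [] => [1]
  | 0, k :: K => (k + 1) :: K
  | i + 1, k :: K => k :: addCell i K

theorem Inserts.map_length {x i : ℕ} {T T' : List (List ℕ)} (h : Inserts x T i T') :
    T'.map List.length = addCell i (T.map List.length) := by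
  induction h with
  | nil x => simp [addCell]
  | append h => simp [addCell]
  | bump h hxy hT ih => simp [addCell, ih]

theorem Inserts.row_le_length {x i : ℕ} {T T' : List (List ℕ)} (h : Inserts x T i T') :
    i ≤ T.length := by
  induction h with
  | nil x => simp
  | append h => simp
  | bump h hxy hT ih => simpa using ih

/-! ### Insertion preserves tableaux; the row bumping lemma. -/

theorem countP_le_mono {c d : ℕ} (h : c ≤ d) (r : List ℕ) :
    r.countP (· ≤ c) ≤ r.countP (· ≤ d) :=
  List.countP_mono_left fun x _ hx => by simp at hx ⊢; omega

theorem countP_lt_mono {c d : ℕ} (h : c ≤ d) (r : List ℕ) :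
    r.countP (· < c) ≤ r.countP (· < d) :=
  List.countP_mono_left fun x _ hx => by simp at hx ⊢; omega

theorem countP_lt_le_countP_le (c : ℕ) (r : List ℕ) :
    r.countP (· < c) ≤ r.countP (· ≤ c) :=
  List.countP_mono_left fun x _ hx => by simp at hx ⊢; omega

theorem countP_le_of_forall {c : ℕ} {r : List ℕ} (h : ∀ e ∈ r, e ≤ c) :
    r.countP (· ≤ c) = r.length :=
  List.countP_eq_length.2 (by simpa using h)

theorem countP_lt_of_forall {c : ℕ} {r : List ℕ} (h : ∀ e ∈ r, e < c) :
    r.countP (· < c) = r.length :=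
  List.countP_eq_length.2 (by simpa using h)

theorem countP_le_eq_zero {c : ℕ} {r : List ℕ} (h : ∀ e ∈ r, c < e) :
    r.countP (· ≤ c) = 0 :=
  List.countP_eq_zero.2 (by simpa using h)

theorem countP_lt_eq_zero {c : ℕ} {r : List ℕ} (h : ∀ e ∈ r, c ≤ e) :
    r.countP (· < c) = 0 :=
  List.countP_eq_zero.2 (by simpa using h)

/-- How the first row changes under insertion, in counting form. -/
theorem Inserts.countP_head {y i : ℕ} {T T' : List (List ℕ)} (h : Inserts y T i T')
    (hT : (T.headD []).Pairwise (· ≤ ·)) (c : ℕ) :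
    (c < y → (T'.headD []).countP (· ≤ c) = (T.headD []).countP (· ≤ c)) ∧
    (T'.headD []).countP (· ≤ y) = (T.headD []).countP (· ≤ y) + 1 ∧
    (y ≤ c → (T'.headD []).countP (· ≤ c) = (T.headD []).countP (· ≤ c) ∨
      (T.headD []).countP (· ≤ c) = (T.headD []).countP (· ≤ y) ∧
      (T'.headD []).countP (· ≤ c) = (T.headD []).countP (· ≤ c) + 1) := by
  cases h with
  | nil x =>
    refine ⟨fun h => ?_, ?_, fun h => ?_⟩ <;> simp <;> omega
  | @append _ r T h =>
    simp only [List.headD_cons, List.countP_append, List.countP_singleton] at *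
    refine ⟨fun h => ?_, ?_, fun h' => Or.inr ⟨?_, ?_⟩⟩
    · simp; omega
    · simp
    · rw [countP_le_of_forall h, countP_le_of_forall fun e he => (h e he).trans h']
    · simpa using h'
  | @bump _ z i l s T T' h hxy hT' =>
    simp only [List.headD_cons, List.countP_append, List.countP_cons, decide_eq_true_eq] at *
    rw [List.pairwise_append, List.pairwise_cons] at hT
    have h0 : ∀ c, c < z → s.countP (· ≤ c) = 0 := fun c hc =>
      countP_le_eq_zero fun e he => hc.trans_le (hT.2.1.1 e he)
    have h1 := h0 y hxy
    have h2 := countP_le_of_forall h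
    refine ⟨fun h => ?_, ?_, fun h' => ?_⟩
    · rw [if_neg (by omega), if_neg (by omega)]
    · rw [if_pos (le_refl y), if_neg (by omega)]
      omega
    · have h3 := countP_le_of_forall fun e he => (h e he).trans h'
      by_cases hz : z ≤ c
      · left; rw [if_pos hz, if_pos h']
      · right
        have := h0 c (by omega)
        rw [if_neg hz, if_neg (by omega), if_pos h']
        omega

theorem IsTableau.head_pairwise {T : List (List ℕ)} (h : IsTableau T) :
    (T.headD []).Pairwise (· ≤ ·) := by
  cases T with
  | nil => simp
  | cons r T => exact h.2.1

/-- Only the columns between a row and the next need care. The row above has one entry lowered from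
`y` to `x`, while the row below gains `y`; `Inserts.countP_head` compares the two changes at every
threshold `c`. -/
theorem Inserts.isTableau {x i : ℕ} {T T' : List (List ℕ)} (h : Inserts x T i T')
    (hT : IsTableau T) : IsTableau T' := by
  induction h with
  | nil x => simp [IsTableau, Dominates]
  | @append x r T h =>
    refine ⟨by simp, ?_, fun c => (hT.2.2.1 c).trans ?_, hT.2.2.2⟩
    · rw [List.pairwise_append]
      exact ⟨hT.2.1, by simp, by simpa using h⟩
    · simp
  | @bump x y i l s T T' h hxy hi ih =>
    obtain ⟨-, hr, hd, hT⟩ := hT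
    rw [List.pairwise_append, List.pairwise_cons] at hr
    refine ⟨by simp, ?_, fun c => ?_, ih hT⟩
    · rw [List.pairwise_append, List.pairwise_cons]
      refine ⟨hr.1, ⟨fun e he => hxy.le.trans (hr.2.1.1 e he), hr.2.1.2⟩, fun e he f hf => ?_⟩
      rcases List.mem_cons.1 hf with rfl | hf
      · exact h e he
      · exact hr.2.2 e he f (List.mem_cons_of_mem _ hf)
    · obtain ⟨h1, h2, h3⟩ := hi.countP_head hT.head_pairwise c
      have hc := hd c
      -- At threshold `y` this says that at most `l.length` entries of the next row are `≤ y`, so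
      -- the bumped letter does not land to the right of the column it left.
      have hy := hd y
      have hs : s.countP (· < y) = 0 := countP_lt_eq_zero hr.2.1.1
      have hl : l.countP (· < y) = l.length :=
        countP_lt_of_forall fun e he => (h e he).trans_lt hxy
      simp only [List.countP_append, List.countP_cons, decide_eq_true_eq] at hc hy ⊢
      rw [if_neg (lt_irrefl y)] at hy
      rcases lt_or_ge c y with hcy | hcy
      · rw [if_neg (by omega)] at hc
        have := h1 hcy
        split_ifs <;> omega
      · rw [if_pos (show x < c by omega)]
        have hl' : l.countP (· < c) = l.length :=
          countP_lt_of_forall fun e he => (h e he).trans_lt (by omega)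
        rcases h3 hcy with h3 | ⟨h3, h3'⟩
        · split_ifs at hc <;> omega
        · omega

theorem Inserts.cons_cases {x i : ℕ} {r : List ℕ} {T U : List (List ℕ)}
    (h : Inserts x (r :: T) i U) :
    (i = 0 ∧ (∀ e ∈ r, e ≤ x) ∧ U = (r ++ [x]) :: T) ∨
    ∃ l y s j T', r = l ++ y :: s ∧ (∀ e ∈ l, e ≤ x) ∧ x < y ∧ Inserts y T j T' ∧ i = j + 1 ∧
      U = (l ++ x :: s) :: T' := by
  generalize hR : r :: T = R at h
  cases h with
  | nil => simp at hR
  | append h =>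
    obtain ⟨rfl, rfl⟩ := List.cons.inj hR
    exact Or.inl ⟨rfl, h, rfl⟩
  | bump h hxy hT =>
    obtain ⟨rfl, rfl⟩ := List.cons.inj hR
    exact Or.inr ⟨_, _, _, _, _, rfl, h, hxy, hT, rfl, rfl⟩

/-- The row bumping lemma, for row indices. -/
theorem Inserts.row_le_row_iff {a b i j : ℕ} {T T₁ T₂ : List (List ℕ)} (h₁ : Inserts a T j T₁)
    (h₂ : Inserts b T₁ i T₂) (hT : IsTableau T) : i ≤ j ↔ a ≤ b := by
  induction h₁ generalizing b i T₂ with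
  | nil x =>
    rcases h₂.cons_cases with ⟨rfl, h, -⟩ | ⟨l, y, s, j, T', hr, -, hy, -, rfl, -⟩
    · simpa using h
    · have : y ∈ [x] := hr ▸ by simp
      simp at this
      omega
  | @append x r T h =>
    rcases h₂.cons_cases with ⟨rfl, h, -⟩ | ⟨l, y, s, j, T', hr, -, hy, -, rfl, -⟩
    · simpa using h x (by simp)
    · have : y ∈ r ++ [x] := hr ▸ by simp
      have : y ≤ x := by
        rcases List.mem_append.1 this with h' | h'
        · exact h y h'
        · simpa using (List.mem_singleton.1 h').le
      omega
  | @bump x y j l s T T' h hxy hi ih =>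
    rcases h₂.cons_cases with ⟨rfl, h, -⟩ | ⟨l', z, s', k, T', hr, hl', hz, hk, rfl, -⟩
    · simpa using h x (by simp)
    · rw [Nat.add_le_add_iff_right, ih hk hT.2.2.2]
      have hys := (List.pairwise_cons.1 (List.pairwise_append.1 hT.2.1).2.1).1
      constructor
      · intro hyz
        by_contra hxb
        -- The two splittings of the new row are compared. Since `b < x`, the entry `z` bumped by
        -- `b` is `x` itself or lies to its left, so `z ≤ x < y`, against `y ≤ z`.
        rcases List.append_eq_append_iff.1 hr with ⟨c, h1, h2⟩ | ⟨c, h1, h2⟩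
        · cases c with
          | nil => simp at h2; omega
          | cons u c =>
            simp at h2
            have := hl' x (by simp [h1, h2.1])
            omega
        · cases c with
          | nil => simp at h2; omega
          | cons u c =>
            simp at h2
            have := h z (by simp [h1, h2.1])
            omega
      · intro hxb
        have hz' : z ∈ l ++ x :: s := hr ▸ by simp
        simp only [List.mem_append, List.mem_cons] at hz'
        rcases hz' with hz' | rfl | hz'
        · have := h z hz'
          omega
        · omega
        · exact hys z hz'

/-! ### Reverse insertion. -/

/-- Row `i` ends in a corner of the tableau. -/
def EndsInCorner : ℕ → List (List ℕ) → Prop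
  | _, [] => False
  | 0, r :: T => (T.headD []).length < r.length
  | i + 1, _ :: T => EndsInCorner i T

/-- The threshold `y` recovers the splitting: `l ++ [x]` consists of the entries below `y` and `s`
of the others. Hence a bump can be undone once the bumped letter is known. -/
theorem split_unique {l l' s s' : List ℕ} {x x' y : ℕ} (hl : ∀ e ∈ l, e ≤ x) (hx : x < y)
    (hs : ∀ e ∈ s, y ≤ e) (hl' : ∀ e ∈ l', e ≤ x') (hx' : x' < y) (hs' : ∀ e ∈ s', y ≤ e)
    (h : l ++ x :: s = l' ++ x' :: s') : l = l' ∧ x = x' ∧ s = s' := by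
  have key : ∀ {l s : List ℕ} {x : ℕ}, (∀ e ∈ l, e ≤ x) → x < y → (∀ e ∈ s, y ≤ e) →
      (l ++ x :: s).filter (· < y) = l ++ [x] ∧ (l ++ x :: s).filter (y ≤ ·) = s := by
    intro l s x hl hx hs
    rw [List.filter_append, List.filter_append, List.filter_cons_of_pos (by simpa),
      List.filter_cons_of_neg (by simpa), List.filter_eq_self.2, List.filter_eq_nil_iff.2,
      List.filter_eq_nil_iff.2, List.filter_eq_self.2]
    · simp
    · simpa using hs
    · intro e he; have := hl e he; simp; omega
    · simpa using hs
    · intro e he; have := hl e he; simp; omega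
  have h1 := key hl hx hs
  have h2 := key hl' hx' hs'
  rw [h] at h1
  have h3 := List.append_inj' (h1.1.symm.trans h2.1) rfl
  exact ⟨h3.1, by simpa using h3.2, h1.2.symm.trans h2.2⟩

theorem Inserts.succ_cases {x i : ℕ} {T U : List (List ℕ)} (h : Inserts x T (i + 1) U) :
    ∃ y l s T₁ T₂, T = (l ++ y :: s) :: T₁ ∧ (∀ e ∈ l, e ≤ x) ∧ x < y ∧ Inserts y T₁ i T₂ ∧
      U = (l ++ x :: s) :: T₂ := by
  generalize hj : i + 1 = j at h
  cases h with
  | nil => simp at hj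
  | append => simp at hj
  | bump h hxy hT =>
    obtain rfl := Nat.succ.inj hj
    exact ⟨_, _, _, _, _, rfl, h, hxy, hT, rfl⟩

/-- Knowing the row of the new cell makes insertion reversible: its last entry is removed, and the
bumps are then undone upwards, each being determined by `split_unique`. -/
theorem Inserts.unique {x x' i : ℕ} {T T' U : List (List ℕ)} (h : Inserts x T i U)
    (h' : Inserts x' T' i U) (hT : IsTableau T) (hT' : IsTableau T') : x = x' ∧ T = T' := by
  induction h generalizing x' T' with
  | nil x =>
    generalize hU : [[x]] = U at h'
    generalize hj : 0 = j at h'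
    cases h' with
    | nil => simpa using hU
    | @append _ r _ h =>
      have := hT'.1
      simp only [List.cons.injEq, List.singleton_eq_append_iff] at hU
      simp_all
    | bump => simp at hj
  | @append x r T h =>
    generalize hU : (r ++ [x]) :: T = U at h'
    generalize hj : 0 = j at h'
    cases h' with
    | nil =>
      have := hT.1
      simp only [List.cons.injEq, List.append_eq_singleton_iff] at hU
      simp_all
    | append h =>
      obtain ⟨h1, rfl⟩ := List.cons.inj hU
      have := List.append_inj' h1 rfl
      simp_all
    | bump => simp at hj
  | @bump x y j l s T T' h hxy hi ih =>
    obtain ⟨z, l', s', T₂, T₂', rfl, hl', hxy', hi', hU⟩ := h'.succ_cases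
    obtain ⟨h1, rfl⟩ := List.cons.inj hU
    obtain ⟨rfl, rfl⟩ := ih hi' hT.2.2.2 hT'.2.2.2
    obtain ⟨rfl, rfl, rfl⟩ := split_unique h hxy
      (List.pairwise_cons.1 (List.pairwise_append.1 hT.2.1).2.1).1 hl' hxy'
      (List.pairwise_cons.1 (List.pairwise_append.1 hT'.2.1).2.1).1 h1
    exact ⟨rfl, rfl⟩

theorem Inserts.mem_head {x i : ℕ} {T T' : List (List ℕ)} (h : Inserts x T i T') :
    x ∈ T'.headD [] := by
  induction h <;> simp

theorem exists_split_of_pairwise {r : List ℕ} {y : ℕ} (hr : r.Pairwise (· ≤ ·))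
    (h : 0 < r.countP (· < y)) :
    ∃ l x s, r = l ++ x :: s ∧ (∀ e ∈ l, e ≤ x) ∧ x < y ∧ ∀ e ∈ s, y ≤ e := by
  induction r using List.reverseRecOn with
  | nil => simp at h
  | append_singleton r z ih =>
    have hr' := List.pairwise_append.1 hr
    by_cases hz : z < y
    · exact ⟨r, z, [], rfl, by simpa using hr'.2.2, hz, by simp⟩
    · obtain ⟨l, x, s, rfl, hl, hx, hs⟩ := ih hr'.1 (by simpa [List.countP_append, hz] using h)
      refine ⟨l, x, s ++ [z], by simp, hl, hx, ?_⟩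
      intro e he
      rcases List.mem_append.1 he with he | he
      · exact hs e he
      · simp at he; omega

theorem exists_inserts {i : ℕ} {U : List (List ℕ)} (hU : IsTableau U) (hi : EndsInCorner i U) :
    ∃ x T, IsTableau T ∧ Inserts x T i U := by
  induction U generalizing i with
  | nil => simp [EndsInCorner] at hi
  | cons r U ih =>
    obtain ⟨hne, hr, hd, hU⟩ := hU
    cases i with
    | zero =>
      rw [EndsInCorner] at hi
      induction r using List.reverseRecOn with
      | nil => exact absurd rfl hne
      | append_singleton r z _ =>
        have hr' := List.pairwise_append.1 hr
        have hz : ∀ e ∈ r, e ≤ z := by simpa using hr'.2.2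
        by_cases hr0 : r = []
        · subst hr0
          cases U with
          | nil => exact ⟨z, [], trivial, Inserts.nil z⟩
          | cons q U => exact absurd (by simpa using hi) hU.1
        · refine ⟨z, r :: U, ⟨hr0, hr'.1, fun c => ?_, hU⟩, Inserts.append hz⟩
          rcases lt_or_ge z c with hc | hc
          · rw [countP_lt_of_forall fun e he => (hz e he).trans_lt hc]
            refine List.countP_le_length.trans ?_
            simpa using Nat.le_of_lt_succ (by simpa using hi)
          · simpa [List.countP_append, not_lt.2 hc] using hd c
    | succ i =>
      obtain ⟨y, T, hT, hy⟩ := ih hU hi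
      -- The letter `y` pushed up from the row below has a smaller entry above it by column
      -- strictness; it replaces the rightmost such entry `x`.
      obtain ⟨l, x, s, rfl, hl, hx, hs⟩ := exists_split_of_pairwise (y := y) hr <|
        (List.countP_pos_iff.2 ⟨y, hy.mem_head, by simp⟩).trans_le (hd y)
      refine ⟨x, (l ++ y :: s) :: T, ⟨by simp, ?_, fun c => ?_, hT⟩, Inserts.bump hl hx hy⟩
      · rw [List.pairwise_append, List.pairwise_cons] at hr ⊢
        refine ⟨hr.1, ⟨hs, hr.2.1.2⟩, fun e he f hf => ?_⟩
        rcases List.mem_cons.1 hf with rfl | hf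
        · exact (hl e he).trans hx.le
        · exact hr.2.2 e he f (List.mem_cons_of_mem _ hf)
      · obtain ⟨h1, h2, h3⟩ := hy.countP_head hT.head_pairwise c
        have hc := hd c
        have hy' := hd y
        have hs' : s.countP (· < y) = 0 := countP_lt_eq_zero hs
        have hl' : l.countP (· < y) = l.length :=
          countP_lt_of_forall fun e he => (hl e he).trans_lt hx
        simp only [List.countP_append, List.countP_cons, decide_eq_true_eq] at hc hy' ⊢
        rw [if_pos hx] at hy'
        rcases lt_or_ge x c with hxc | hxc
        · have hlc : l.countP (· < c) = l.length :=
            countP_lt_of_forall fun e he => (hl e he).trans_lt hxc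
          rw [if_pos hxc] at hc
          rcases le_or_gt c y with hcy | hcy
          · have := countP_le_mono hcy (T.headD [])
            rw [if_neg (by omega)]
            omega
          · rw [if_pos hcy]
            have := h3 hcy.le
            omega
        · rw [if_neg (by omega)] at hc
          rw [if_neg (by omega)]
          have := h1 (by omega)
          omega

/-! ### Knuth moves preserve the lengths of monotone subsequences. -/

/-- Every `R`-chain in `w` can be replaced by one in `w'` of the same length without violating
any bound on it. -/
def ChainsTransfer (R : ℕ → ℕ → Prop) (w w' : List ℕ) : Prop :=
  ∀ α : List ℕ, α.Sublist w → α.Pairwise R → ∃ β : List ℕ, β.Sublist w' ∧ β.Pairwise R ∧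
    β.length = α.length ∧ (∀ u, (∀ a ∈ α, R u a) → ∀ b ∈ β, R u b) ∧
    (∀ v, (∀ a ∈ α, R a v) → ∀ b ∈ β, R b v)

theorem ChainsTransfer.refl (R : ℕ → ℕ → Prop) (w : List ℕ) : ChainsTransfer R w w :=
  fun α h hp => ⟨α, h, hp, rfl, fun _ h => h, fun _ h => h⟩

theorem ChainsTransfer.trans {R : ℕ → ℕ → Prop} {w₁ w₂ w₃ : List ℕ}
    (h : ChainsTransfer R w₁ w₂) (h' : ChainsTransfer R w₂ w₃) : ChainsTransfer R w₁ w₃ := by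
  intro α hα hp
  obtain ⟨β, h1, h2, h3, h4, h5⟩ := h α hα hp
  obtain ⟨γ, k1, k2, k3, k4, k5⟩ := h' β h1 h2
  exact ⟨γ, k1, k2, k3.trans h3, fun u hu => k4 u (h4 u hu), fun v hv => k5 v (h5 v hv)⟩

/-- The two bound clauses make gluing possible: letters of the second half bound the first half from
above in `R`, this survives the replacement of the first half, and the new letters then serve as
lower bounds for the second. So Knuth moves may be applied inside a longer word. -/
theorem ChainsTransfer.append {R : ℕ → ℕ → Prop} {w w' z z' : List ℕ}
    (h : ChainsTransfer R w w') (h' : ChainsTransfer R z z') :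
    ChainsTransfer R (w ++ z) (w' ++ z') := by
  intro α hα hp
  obtain ⟨α₁, α₂, rfl, hα₁, hα₂⟩ := List.sublist_append_iff.1 hα
  rw [List.pairwise_append] at hp
  obtain ⟨β, h1, h2, h3, h4, h5⟩ := h α₁ hα₁ hp.1
  obtain ⟨γ, k1, k2, k3, k4, k5⟩ := h' α₂ hα₂ hp.2.1
  refine ⟨β ++ γ, h1.append k1, List.pairwise_append.2 ⟨h2, k2, fun b hb c hc => ?_⟩,
    by simp [h3, k3], fun u hu b hb => ?_, fun v hv b hb => ?_⟩
  · exact k4 b (fun a ha => h5 a (fun a' ha' => hp.2.2 a' ha' a ha) b hb) c hc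
  · rcases List.mem_append.1 hb with hb | hb
    · exact h4 u (fun a ha => hu a (List.mem_append_left _ ha)) b hb
    · exact k4 u (fun a ha => hu a (List.mem_append_right _ ha)) b hb
  · rcases List.mem_append.1 hb with hb | hb
    · exact h5 v (fun a ha => hv a (List.mem_append_left _ ha)) b hb
    · exact k5 v (fun a ha => hv a (List.mem_append_right _ ha)) b hb

/-- Chains for both orders transfer in both directions; Knuth equivalent words have this
property. -/
def SameChains (w w' : List ℕ) : Prop :=
  (ChainsTransfer (· ≤ ·) w w' ∧ ChainsTransfer (· ≤ ·) w' w) ∧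
    ChainsTransfer (· > ·) w w' ∧ ChainsTransfer (· > ·) w' w

theorem SameChains.refl (w : List ℕ) : SameChains w w :=
  ⟨⟨.refl _ w, .refl _ w⟩, .refl _ w, .refl _ w⟩

theorem SameChains.trans {w₁ w₂ w₃ : List ℕ} (h : SameChains w₁ w₂) (h' : SameChains w₂ w₃) :
    SameChains w₁ w₃ :=
  ⟨⟨h.1.1.trans h'.1.1, h'.1.2.trans h.1.2⟩, h.2.1.trans h'.2.1, h'.2.2.trans h.2.2⟩

theorem SameChains.append {w w' z z' : List ℕ} (h : SameChains w w') (h' : SameChains z z') :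
    SameChains (w ++ z) (w' ++ z') :=
  ⟨⟨h.1.1.append h'.1.1, h.1.2.append h'.1.2⟩, h.2.1.append h'.2.1, h.2.2.append h'.2.2⟩

theorem eq_of_sublist_three {α : Type*} {p q r : α} {l : List α} (h : l.Sublist [p, q, r]) :
    l = [] ∨ l = [p] ∨ l = [q] ∨ l = [p, q] ∨ l = [r] ∨ l = [p, r] ∨ l = [q, r] ∨
      l = [p, q, r] := by
  have := List.mem_sublists.2 h
  simpa [List.sublists] using this

/-- To transfer chains between three-letter words, it suffices to treat those of length at
least two. -/
theorem ChainsTransfer.of_three {R : ℕ → ℕ → Prop} {p q r : ℕ} {w : List ℕ}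
    (hp : p ∈ w) (hq : q ∈ w) (hr : r ∈ w) (hpqr : ¬ (R p q ∧ R q r))
    (h : ∀ a b, R a b → (a = p ∧ b = q) ∨ (a = p ∧ b = r) ∨ (a = q ∧ b = r) →
      ∃ a' b', [a', b'].Sublist w ∧ R a' b' ∧ (∀ u, R u a → R u b → R u a' ∧ R u b') ∧
        ∀ v, R a v → R b v → R a' v ∧ R b' v) : ChainsTransfer R [p, q, r] w := by
  intro α hα hR
  have h1 : ∀ a ∈ w, ∃ β : List ℕ, β.Sublist w ∧ β.Pairwise R ∧
      β.length = [a].length ∧ (∀ u, (∀ x ∈ [a], R u x) → ∀ b ∈ β, R u b) ∧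
      (∀ v, (∀ x ∈ [a], R x v) → ∀ b ∈ β, R b v) := fun a ha =>
    ⟨[a], List.singleton_sublist.2 ha, by simp, rfl, fun _ h => h, fun _ h => h⟩
  have h2 : ∀ a b, R a b → (a = p ∧ b = q) ∨ (a = p ∧ b = r) ∨ (a = q ∧ b = r) →
      ∃ β : List ℕ, β.Sublist w ∧ β.Pairwise R ∧
      β.length = [a, b].length ∧ (∀ u, (∀ x ∈ [a, b], R u x) → ∀ b ∈ β, R u b) ∧
      (∀ v, (∀ x ∈ [a, b], R x v) → ∀ b ∈ β, R b v) := by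
    intro a b hab hpq
    obtain ⟨a', b', k1, k2, k3, k4⟩ := h a b hab hpq
    refine ⟨[a', b'], k1, by simpa using k2, rfl, fun u hu => ?_, fun v hv => ?_⟩
    · simp only [List.mem_cons, List.not_mem_nil, or_false, forall_eq_or_imp, forall_eq] at hu ⊢
      exact k3 u hu.1 hu.2
    · simp only [List.mem_cons, List.not_mem_nil, or_false, forall_eq_or_imp, forall_eq] at hv ⊢
      exact k4 v hv.1 hv.2
  rcases eq_of_sublist_three hα with rfl | rfl | rfl | rfl | rfl | rfl | rfl | rfl
  · exact ⟨[], by simp, by simp, rfl, fun _ h => h, fun _ h => h⟩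
  · exact h1 _ hp
  · exact h1 _ hq
  · exact h2 _ _ (by simpa using hR) (by simp)
  · exact h1 _ hr
  · exact h2 _ _ (by simpa using hR) (by simp)
  · exact h2 _ _ (by simpa using hR) (by simp)
  · simp at hR
    exact absurd ⟨hR.1.1, hR.2⟩ hpqr

/-- The move swaps `z` and `x`, so only the chains using both are lost. The weak chain `x, z` is
replaced by `y, z`, and the strict descent `z, x` by `y, x`. -/
theorem SameChains.knuth_left {x y z : ℕ} (hxy : x < y) (hyz : y ≤ z) :
    SameChains [y, z, x] [y, x, z] := by
  have h : ∀ {p q r : ℕ}, [p, q].Sublist [p, q, r] ∧ [p, r].Sublist [p, q, r] ∧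
      [q, r].Sublist [p, q, r] := by
    intro p q r
    exact ⟨List.mem_sublists.1 (by simp [List.sublists]),
      List.mem_sublists.1 (by simp [List.sublists]), List.mem_sublists.1 (by simp [List.sublists])⟩
  refine ⟨⟨?_, ?_⟩, ?_, ?_⟩ <;>
    refine ChainsTransfer.of_three (by simp) (by simp) (by simp) (by omega) ?_ <;>
    rintro a b hab (⟨rfl, rfl⟩ | ⟨rfl, rfl⟩ | ⟨rfl, rfl⟩)
  · exact ⟨_, _, h.2.1, hab, by omega, by omega⟩
  · omega
  · omega
  · omega
  · exact ⟨_, _, h.1, hab, by omega, by omega⟩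
  · exact ⟨_, _, h.1, hyz, by omega, by omega⟩
  · omega
  · exact ⟨_, _, h.1, hab, by omega, by omega⟩
  · exact ⟨_, _, h.1, hxy, by omega, by omega⟩
  · exact ⟨_, _, h.2.1, hab, by omega, by omega⟩
  · omega
  · omega

/-- Here the weak chain `x, z` is replaced by `x, y`, and the strict descent `z, x` by `z, y`. -/
theorem SameChains.knuth_right {x y z : ℕ} (hxy : x ≤ y) (hyz : y < z) :
    SameChains [x, z, y] [z, x, y] := by
  have h : ∀ {p q r : ℕ}, [p, q].Sublist [p, q, r] ∧ [p, r].Sublist [p, q, r] ∧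
      [q, r].Sublist [p, q, r] := by
    intro p q r
    exact ⟨List.mem_sublists.1 (by simp [List.sublists]),
      List.mem_sublists.1 (by simp [List.sublists]), List.mem_sublists.1 (by simp [List.sublists])⟩
  refine ⟨⟨?_, ?_⟩, ?_, ?_⟩ <;>
    refine ChainsTransfer.of_three (by simp) (by simp) (by simp) (by omega) ?_ <;>
    rintro a b hab (⟨rfl, rfl⟩ | ⟨rfl, rfl⟩ | ⟨rfl, rfl⟩)
  · exact ⟨_, _, h.2.2, hxy, by omega, by omega⟩
  · exact ⟨_, _, h.2.2, hab, by omega, by omega⟩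
  · omega
  · omega
  · omega
  · exact ⟨_, _, h.2.1, hab, by omega, by omega⟩
  · omega
  · omega
  · exact ⟨_, _, h.2.1, hab, by omega, by omega⟩
  · exact ⟨_, _, h.2.2, hyz, by omega, by omega⟩
  · exact ⟨_, _, h.2.2, hab, by omega, by omega⟩
  · omega

/-- The letter `x` travels left through `s`, one `knuth_left` move per letter, until it stands just
after `y`. -/
theorem SameChains.bump_right {x y : ℕ} {s : List ℕ} (hxy : x < y)
    (hs : (y :: s).Pairwise (· ≤ ·)) : SameChains (y :: s ++ [x]) (y :: x :: s) := by
  induction s generalizing y with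
  | nil => exact .refl _
  | cons z s ih =>
    rw [List.pairwise_cons] at hs
    have hyz := hs.1 z (by simp)
    exact ((SameChains.refl [y]).append (ih (hxy.trans_le hyz) hs.2)).trans
      ((SameChains.knuth_left hxy hyz).append (.refl s))

/-- Now `y` travels left out of the row, one `knuth_right` move per letter of `l`. Together with
`bump_right` this realises one row bump on the reading word. -/
theorem SameChains.bump_left {x y : ℕ} {l : List ℕ} (hxy : x < y)
    (hl : (l ++ [x]).Pairwise (· ≤ ·)) : SameChains (l ++ [y, x]) (y :: l ++ [x]) := by
  induction l using List.reverseRecOn generalizing x with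
  | nil => exact .refl _
  | append_singleton l z ih =>
    rw [List.pairwise_append] at hl
    have hzx := hl.2.2 z (by simp) x (by simp)
    have h1 := (SameChains.refl l).append (SameChains.knuth_right hzx hxy)
    have h2 := (ih (hzx.trans_lt hxy) hl.1).append (SameChains.refl [x])
    simp only [List.append_assoc, List.cons_append, List.nil_append] at h1 h2 ⊢
    exact h1.trans h2

theorem SameChains.bump {x y : ℕ} {l s : List ℕ} (hl : ∀ e ∈ l, e ≤ x) (hxy : x < y)
    (hr : (l ++ y :: s).Pairwise (· ≤ ·)) :
    SameChains (l ++ y :: s ++ [x]) (y :: l ++ x :: s) := by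
  rw [List.pairwise_append] at hr
  have h1 := (SameChains.refl l).append (SameChains.bump_right hxy hr.2.1)
  have h2 := (SameChains.bump_left hxy (l := l)
    (List.pairwise_append.2 ⟨hr.1, by simp, by simpa using hl⟩)).append (.refl s)
  simp only [List.append_assoc, List.cons_append, List.nil_append] at h1 h2 ⊢
  exact h1.trans h2

/-- The rows of a tableau, read from bottom to top. -/
def readingWord (T : List (List ℕ)) : List ℕ := T.reverse.flatten

theorem readingWord_cons (r : List ℕ) (T : List (List ℕ)) :
    readingWord (r :: T) = readingWord T ++ r := by
  simp [readingWord]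

theorem Inserts.sameChains {x i : ℕ} {T T' : List (List ℕ)} (h : Inserts x T i T')
    (hT : IsTableau T) : SameChains (readingWord T ++ [x]) (readingWord T') := by
  induction h with
  | nil x => exact .refl _
  | append h => simpa [readingWord_cons] using SameChains.refl _
  | @bump x y i l s T T' h hxy hi ih =>
    have h1 := (SameChains.refl (readingWord T)).append (SameChains.bump h hxy hT.2.1)
    have h2 := (ih hT.2.2.2).append (SameChains.refl (l ++ x :: s))
    simp only [readingWord_cons, List.append_assoc, List.cons_append, List.nil_append] at h1 h2 ⊢
    exact h1.trans h2

/-! ### Schensted's theorem for words. -/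

/-- The insertion tableau of a word. -/
def insertionTableau (w : List ℕ) : List (List ℕ) :=
  w.foldl (fun T x => tableauInsert x T) []

theorem insertionTableau_append_singleton (w : List ℕ) (x : ℕ) :
    insertionTableau (w ++ [x]) = tableauInsert x (insertionTableau w) := by
  simp [insertionTableau]

theorem isTableau_insertionTableau (w : List ℕ) : IsTableau (insertionTableau w) := by
  induction w using List.reverseRecOn with
  | nil => trivial
  | append_singleton w x ih =>
    rw [insertionTableau_append_singleton]
    exact (inserts_tableauInsert x _).isTableau ih

theorem flatten_insertionTableau_perm (w : List ℕ) : (insertionTableau w).flatten.Perm w := by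
  induction w using List.reverseRecOn with
  | nil => exact .refl _
  | append_singleton w x ih =>
    rw [insertionTableau_append_singleton]
    exact (inserts_tableauInsert x _).flatten_perm.trans
      ((ih.cons x).trans (List.perm_append_singleton x w).symm)

theorem sameChains_insertionTableau (w : List ℕ) :
    SameChains w (readingWord (insertionTableau w)) := by
  induction w using List.reverseRecOn with
  | nil => exact .refl _
  | append_singleton w x ih =>
    rw [insertionTableau_append_singleton]
    exact (ih.append (.refl [x])).trans
      ((inserts_tableauInsert x _).sameChains (isTableau_insertionTableau w))

/-- The bound `v` is what the induction needs. If `c` is the first letter taken from the top row,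
the letters from lower rows are `≤ c`, so by induction and `Dominates` there are at most as many as
top-row entries `< c`; the remaining letters are top-row entries between `c` and `v`. -/
theorem length_le_countP_head {T : List (List ℕ)} (hT : IsTableau T) {α : List ℕ}
    (hα : α.Sublist (readingWord T)) (hp : α.Pairwise (· ≤ ·)) {v : ℕ} (hv : ∀ a ∈ α, a ≤ v) :
    α.length ≤ (T.headD []).countP (· ≤ v) := by
  induction T generalizing α v with
  | nil => simp_all [readingWord]
  | cons r T ih =>
    rw [readingWord_cons] at hα
    obtain ⟨α₁, α₂, rfl, h₁, h₂⟩ := List.sublist_append_iff.1 hα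
    rw [List.pairwise_append] at hp
    cases α₂ with
    | nil =>
      simp only [List.append_nil] at hv ⊢
      exact (ih hT.2.2.2 h₁ hp.1 hv).trans ((hT.2.2.1 v).trans (countP_lt_le_countP_le v r))
    | cons c α₂ =>
      have hc : ∀ a ∈ c :: α₂, c ≤ a ∧ a ≤ v := by
        intro a ha
        refine ⟨?_, hv a (List.mem_append_right _ ha)⟩
        rcases List.mem_cons.1 ha with rfl | ha
        · exact le_rfl
        · exact (List.pairwise_cons.1 hp.2.1).1 a ha
      have hcv := (hc c (by simp)).2
      have k1 := (ih hT.2.2.2 h₁ hp.1 fun a ha => hp.2.2 a ha c (by simp)).trans (hT.2.2.1 c)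
      have k2 : (c :: α₂).length ≤ r.countP (fun e => c ≤ e ∧ e ≤ v) := by
        rw [← (List.countP_eq_length (p := fun e => decide (c ≤ e ∧ e ≤ v)) (l := c :: α₂)).2
          fun a ha => decide_eq_true (hc a ha)]
        exact h₂.countP_le
      have k3 : r.countP (· < c) + r.countP (fun e => c ≤ e ∧ e ≤ v) = r.countP (· ≤ v) := by
        clear hT h₂ k1 k2 hα
        induction r with
        | nil => rfl
        | cons e r ih =>
          simp only [List.countP_cons, decide_eq_true_eq]
          split_ifs <;> omega
      rw [List.length_append]
      simpa using (add_le_add k1 k2).trans k3.le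

/-- A weakly increasing row contributes at most one letter to a strictly decreasing chain. -/
theorem length_le_of_pairwise_gt {T : List (List ℕ)} (hT : IsTableau T) {α : List ℕ}
    (hα : α.Sublist (readingWord T)) (hp : α.Pairwise (· > ·)) : α.length ≤ T.length := by
  induction T generalizing α with
  | nil => simp_all [readingWord]
  | cons r T ih =>
    rw [readingWord_cons] at hα
    obtain ⟨α₁, α₂, rfl, h₁, h₂⟩ := List.sublist_append_iff.1 hα
    rw [List.pairwise_append] at hp
    have k := ih hT.2.2.2 h₁ hp.1
    have : α₂.length ≤ 1 := by
      have hr := hT.2.1.sublist h₂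
      match α₂, hr, hp.2.1 with
      | [], _, _ => simp
      | [_], _, _ => simp
      | a :: b :: _, h, h' =>
        have := (List.pairwise_cons.1 h).1 b (by simp)
        have := (List.pairwise_cons.1 h').1 b (by simp)
        omega
    simp
    omega

/-- The chain is the first column, read upwards. The last clause keeps the corner entry as a lower
bound, so that the next row's first entry can be appended. -/
theorem exists_chain_gt {T : List (List ℕ)} (hT : IsTableau T) :
    ∃ α : List ℕ, α.Sublist (readingWord T) ∧ α.Pairwise (· > ·) ∧ α.length = T.length ∧
      ∀ e ∈ (T.headD []).head?, ∀ a ∈ α, e ≤ a := by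
  induction T with
  | nil => exact ⟨[], by simp⟩
  | cons r T ih =>
    obtain ⟨α, h1, h2, h3, h4⟩ := ih hT.2.2.2
    obtain ⟨hne, hr, hd, hT⟩ := hT
    obtain ⟨e, r, rfl⟩ := List.exists_cons_of_ne_nil hne
    have key : ∀ a ∈ α, e < a := by
      cases T with
      | nil => simp_all
      | cons q T =>
        obtain ⟨f, q, rfl⟩ := List.exists_cons_of_ne_nil hT.1
        intro a ha
        refine lt_of_lt_of_le ?_ (h4 f (by simp) a ha)
        have hf := hd f
        have : 0 < (f :: q).countP (· ≤ f) := List.countP_pos_iff.2 ⟨f, by simp⟩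
        obtain ⟨g, hg, hgf⟩ := List.countP_pos_iff.1 (this.trans_le hf)
        simp only [decide_eq_true_eq] at hgf
        rcases List.mem_cons.1 hg with rfl | hg
        · exact hgf
        · exact ((List.pairwise_cons.1 hr).1 g hg).trans_lt hgf
    refine ⟨α ++ [e], ?_, ?_, by simp [h3], ?_⟩
    · rw [readingWord_cons]
      exact h1.append (by simp)
    · rw [List.pairwise_append]
      exact ⟨h2, by simp, by simpa using key⟩
    · intro f hf a ha
      simp at hf
      subst hf
      rcases List.mem_append.1 ha with ha | ha
      · exact (key a ha).le
      · simp at ha; omega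

/-- Schensted's theorem on weakly increasing subsequences. -/
theorem le_length_head_insertionTableau {w : List ℕ} {k : ℕ} :
    k ≤ ((insertionTableau w).headD []).length ↔
      ∃ α : List ℕ, α.Sublist w ∧ α.Pairwise (· ≤ ·) ∧ α.length = k := by
  have hT := isTableau_insertionTableau w
  obtain ⟨⟨h1, h2⟩, -⟩ := sameChains_insertionTableau w
  constructor
  · intro hk
    have hs : ((insertionTableau w).headD []).Sublist (readingWord (insertionTableau w)) := by
      cases insertionTableau w with
      | nil => simp
      | cons r T => rw [readingWord_cons]; simp
    obtain ⟨β, k1, k2, k3, -⟩ := h2 (((insertionTableau w).headD []).take k)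
      ((List.take_sublist _ _).trans hs) (hT.head_pairwise.sublist (List.take_sublist _ _))
    exact ⟨β, k1, k2, by rw [k3, List.length_take, min_eq_left hk]⟩
  · rintro ⟨α, k1, k2, rfl⟩
    obtain ⟨β, l1, l2, l3, -⟩ := h1 α k1 k2
    rw [← l3]
    -- The sum serves merely as a bound for all letters of `β`.
    exact (length_le_countP_head hT l1 l2 (v := β.sum) fun a ha =>
      List.single_le_sum (by simp) a ha).trans List.countP_le_length

/-- Schensted's theorem on strictly decreasing subsequences. -/
theorem le_length_insertionTableau {w : List ℕ} {k : ℕ} :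
    k ≤ (insertionTableau w).length ↔
      ∃ α : List ℕ, α.Sublist w ∧ α.Pairwise (· > ·) ∧ α.length = k := by
  have hT := isTableau_insertionTableau w
  obtain ⟨-, h1, h2⟩ := sameChains_insertionTableau w
  constructor
  · intro hk
    obtain ⟨α, a1, a2, a3, -⟩ := exists_chain_gt hT
    obtain ⟨β, k1, k2, k3, -⟩ := h2 (α.take k)
      ((List.take_sublist _ _).trans a1) (a2.sublist (List.take_sublist _ _))
    exact ⟨β, k1, k2, by rw [k3, List.length_take, min_eq_left (a3 ▸ hk)]⟩
  · rintro ⟨α, k1, k2, rfl⟩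
    obtain ⟨β, l1, l2, l3, -⟩ := h1 α k1 k2
    rw [← l3]
    exact length_le_of_pairwise_gt hT l1 l2

/-! ### The RSK correspondence for two-line arrays. -/

/-- Append the entry `v` to row `i` of an array of rows. -/
def appendToRow : ℕ → ℕ → List (List ℕ) → List (List ℕ)
  | _, v, [] => [[v]]
  | 0, v, r :: Q => (r ++ [v]) :: Q
  | i + 1, v, r :: Q => r :: appendToRow i v Q

/-- The Robinson–Schensted–Knuth map. The two-line array is given as a list of pairs
(recorded value, inserted letter), the last pair coming first. -/
def rsk : List (ℕ × ℕ) → List (List ℕ) × List (List ℕ)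
  | [] => ([], [])
  | p :: w =>
    (tableauInsert p.2 (rsk w).1, appendToRow (insertionRow p.2 (rsk w).1) p.1 (rsk w).2)

/-- Two-line arrays, in reverse order, whose pairs are sorted lexicographically. -/
def IsBiword (w : List (ℕ × ℕ)) : Prop :=
  w.Pairwise fun p q => q.1 < p.1 ∨ q.1 = p.1 ∧ q.2 ≤ p.2

/-- All entries of `Q` are at most `v`, and `v` does not occur above row `i`. -/
def BoundedAt (v i : ℕ) (Q : List (List ℕ)) : Prop :=
  (∀ r ∈ Q, ∀ e ∈ r, e ≤ v) ∧ ∀ r ∈ Q.take i, ∀ e ∈ r, e < v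

theorem map_length_appendToRow (i v : ℕ) (Q : List (List ℕ)) :
    (appendToRow i v Q).map List.length = addCell i (Q.map List.length) := by
  induction Q generalizing i with
  | nil => cases i <;> simp [appendToRow, addCell]
  | cons r Q ih => cases i <;> simp [appendToRow, addCell, ih]

theorem appendToRow_ne_nil (i v : ℕ) (Q : List (List ℕ)) : appendToRow i v Q ≠ [] := by
  cases Q <;> cases i <;> simp [appendToRow]

theorem flatten_appendToRow_perm (i v : ℕ) (Q : List (List ℕ)) :
    (appendToRow i v Q).flatten.Perm (v :: Q.flatten) := by
  induction Q generalizing i with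
  | nil => cases i <;> simp [appendToRow]
  | cons r Q ih =>
    cases i with
    | zero => simp [appendToRow]
    | succ i => simpa [appendToRow] using ((ih i).append_left r).trans List.perm_middle

theorem take_appendToRow {i v : ℕ} {Q : List (List ℕ)} (h : i ≤ Q.length) :
    (appendToRow i v Q).take i = Q.take i := by
  induction Q generalizing i with
  | nil => simp_all
  | cons r Q ih =>
    cases i with
    | zero => simp
    | succ i => simpa [appendToRow] using ih (by simpa using h)

theorem exists_mem_take_appendToRow {i v : ℕ} {Q : List (List ℕ)} (h : i ≤ Q.length) :
    ∃ r ∈ (appendToRow i v Q).take (i + 1), v ∈ r := by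
  induction Q generalizing i with
  | nil => simp_all [appendToRow]
  | cons r Q ih =>
    cases i with
    | zero => simp [appendToRow]
    | succ i =>
      obtain ⟨q, hq, hv⟩ := ih (i := i) (by simpa using h)
      exact ⟨q, by simp only [appendToRow, List.take_succ_cons, List.mem_cons]; exact Or.inr hq, hv⟩

theorem forall_mem_appendToRow {v i : ℕ} {Q : List (List ℕ)} {p : ℕ → Prop} (hv : p v)
    (h : ∀ r ∈ Q, ∀ e ∈ r, p e) : ∀ r ∈ appendToRow i v Q, ∀ e ∈ r, p e := by
  intro r hr e he
  have := (flatten_appendToRow_perm i v Q).mem_iff.1 (List.mem_flatten.2 ⟨r, hr, he⟩)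
  rcases List.mem_cons.1 this with rfl | h'
  · exact hv
  · obtain ⟨q, hq, he⟩ := List.mem_flatten.1 h'
    exact h q hq e he

theorem BoundedAt.append {v i : ℕ} {Q : List (List ℕ)} (h : BoundedAt v i Q)
    (hi : i ≤ Q.length) : BoundedAt v i (appendToRow i v Q) := by
  refine ⟨forall_mem_appendToRow le_rfl h.1, ?_⟩
  rw [take_appendToRow hi]
  exact h.2

theorem BoundedAt.row_le {v i j : ℕ} {Q Q' : List (List ℕ)} (h : BoundedAt v i Q)
    (hQ : Q = appendToRow j v Q') (hj : j ≤ Q'.length) : i ≤ j := by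
  by_contra hij
  obtain ⟨r, hr, hv⟩ := exists_mem_take_appendToRow (v := v) hj
  rw [← hQ] at hr
  exact lt_irrefl _ (h.2 r ((List.take_sublist_take_left (by omega)).subset hr) v hv)

/-- Nonempty rows are required because appending to an empty row and opening a new row give the same
array. -/
theorem appendToRow_injective {i v : ℕ} {Q Q' : List (List ℕ)} (hQ : ∀ r ∈ Q, r ≠ [])
    (hQ' : ∀ r ∈ Q', r ≠ []) (h : appendToRow i v Q = appendToRow i v Q') : Q = Q' := by
  induction Q generalizing i Q' with
  | nil =>
    cases Q' with
    | nil => rfl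
    | cons r Q' =>
      cases i with
      | zero =>
        simp only [appendToRow, List.cons.injEq, List.singleton_eq_append_iff] at h
        simp_all
      | succ i => cases Q' <;> cases i <;> simp [appendToRow] at h
  | cons r Q ih =>
    cases Q' with
    | nil =>
      cases i with
      | zero =>
        simp only [appendToRow, List.cons.injEq, List.append_eq_singleton_iff] at h
        simp_all
      | succ i => cases Q <;> cases i <;> simp [appendToRow] at h
    | cons r' Q' =>
      cases i with
      | zero => simpa [appendToRow] using h
      | succ i =>
        simp only [appendToRow, List.cons.injEq] at h
        rw [h.1, ih (fun r hr => hQ r (by simp [hr])) (fun r hr => hQ' r (by simp [hr])) h.2]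

theorem IsTableau.ne_nil {T : List (List ℕ)} (h : IsTableau T) : ∀ r ∈ T, r ≠ [] := by
  induction T with
  | nil => simp
  | cons r T ih => simpa using ⟨h.1, ih h.2.2.2⟩

theorem addCell_injective {i : ℕ} {K K' : List ℕ} (hK : ∀ k ∈ K, k ≠ 0) (hK' : ∀ k ∈ K', k ≠ 0)
    (h : addCell i K = addCell i K') : K = K' := by
  induction K generalizing i K' with
  | nil =>
    cases K' with
    | nil => rfl
    | cons r Q' =>
      cases i with
      | zero => simp_all [addCell]
      | succ i => cases Q' <;> cases i <;> simp [addCell] at h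
  | cons r Q ih =>
    cases K' with
    | nil =>
      cases i with
      | zero => simp_all [addCell]
      | succ i => cases Q <;> cases i <;> simp [addCell] at h
    | cons r' Q' =>
      cases i with
      | zero => simpa [addCell] using h
      | succ i =>
        simp only [addCell, List.cons.injEq] at h
        rw [h.1, ih (fun r hr => hK r (by simp [hr])) (fun r hr => hK' r (by simp [hr])) h.2]

/-- The last recorded cell can be recognised: `v` is the largest entry, and `i` is the topmost row
in which it occurs. -/
theorem appendToRow_boundedAt_injective {v v' i i' : ℕ} {Q Q' : List (List ℕ)} (hQ : IsTableau Q)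
    (hQ' : IsTableau Q') (hb : BoundedAt v i Q) (hb' : BoundedAt v' i' Q') (hi : i ≤ Q.length)
    (hi' : i' ≤ Q'.length) (h : appendToRow i v Q = appendToRow i' v' Q') :
    v = v' ∧ i = i' ∧ Q = Q' := by
  have hb₂ := hb.append hi
  have hb₂' := hb'.append hi'
  obtain ⟨r, hr, hv⟩ := exists_mem_take_appendToRow (v := v) hi
  obtain ⟨r', hr', hv'⟩ := exists_mem_take_appendToRow (v := v') hi'
  obtain rfl : v = v' :=
    le_antisymm (hb₂'.1 r (h ▸ List.mem_of_mem_take hr) v hv)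
      (hb₂.1 r' (h ▸ List.mem_of_mem_take hr') v' hv')
  obtain rfl : i = i' := le_antisymm (hb₂.row_le h hi') (hb₂'.row_le h.symm hi)
  exact ⟨rfl, rfl, appendToRow_injective hQ.ne_nil hQ'.ne_nil h⟩

theorem Dominates.length_le {r s : List ℕ} (h : Dominates r s) : s.length ≤ r.length := by
  have := h s.sum
  rw [countP_le_of_forall fun e he => List.single_le_sum (by simp) e he] at this
  exact this.trans List.countP_le_length

theorem IsTableau.shape_pairwise {T : List (List ℕ)} (h : IsTableau T) :
    (T.map List.length).Pairwise (· ≥ ·) := by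
  induction T with
  | nil => simp
  | cons r T ih =>
    rw [List.map_cons, List.pairwise_cons]
    refine ⟨fun k hk => ?_, ih h.2.2.2⟩
    cases T with
    | nil => simp at hk
    | cons q T =>
      have hq := h.2.2.1.length_le
      have h' := ih h.2.2.2
      rw [List.map_cons, List.pairwise_cons] at h'
      rcases List.mem_cons.1 hk with rfl | hk
      · exact hq
      · exact (h'.1 k hk).trans hq

theorem IsTableau.append {v i : ℕ} {Q : List (List ℕ)} (hQ : IsTableau Q)
    (hb : BoundedAt v i Q) (hs : (addCell i (Q.map List.length)).Pairwise (· ≥ ·)) :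
    IsTableau (appendToRow i v Q) := by
  induction Q generalizing i with
  | nil => simp [appendToRow, IsTableau, Dominates]
  | cons r Q ih =>
    obtain ⟨hne, hr, hd, hQ⟩ := hQ
    cases i with
    | zero =>
      refine ⟨by simp, ?_, fun c => (hd c).trans (by simp), hQ⟩
      rw [List.pairwise_append]
      exact ⟨hr, by simp, by simpa using hb.1 r (by simp)⟩
    | succ i =>
      simp only [List.map_cons, addCell, List.pairwise_cons] at hs
      refine ⟨hne, hr, fun c => ?_, ih hQ ⟨fun r hr => hb.1 r (by simp [hr]), fun r hr =>
        hb.2 r (by simp [hr])⟩ hs.2⟩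
      have hrv : ∀ e ∈ r, e < v := hb.2 r (by simp)
      have hlen : ((appendToRow i v Q).headD []).length ≤ r.length := by
        cases hQ' : appendToRow i v Q with
        | nil => simp
        | cons q Q' =>
          refine hs.1 q.length ?_
          rw [← map_length_appendToRow i v, hQ']
          simp
      rcases le_or_gt v c with hc | hc
      · rw [countP_lt_of_forall fun e he => (hrv e he).trans_le hc]
        exact List.countP_le_length.trans hlen
      · refine le_trans (le_of_eq ?_) (hd c)
        cases Q <;> cases i <;> simp [appendToRow, hc]

/-- Pairs of semistandard tableaux of the same shape. -/
def SameShape (p : List (List ℕ) × List (List ℕ)) : Prop :=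
  IsTableau p.1 ∧ IsTableau p.2 ∧ p.1.map List.length = p.2.map List.length

theorem SameShape.length_eq {p : List (List ℕ) × List (List ℕ)} (h : SameShape p) :
    p.1.length = p.2.length := by
  simpa using congrArg List.length h.2.2

theorem SameShape.insertionRow_le {p : List (List ℕ) × List (List ℕ)} (h : SameShape p) (a : ℕ) :
    insertionRow a p.1 ≤ p.2.length :=
  h.length_eq ▸ (inserts_tableauInsert a p.1).row_le_length

/-- Pairs with equal recorded value arrive with weakly increasing letters, so by row bumping their
new cells move weakly upwards. Hence the value being recorded does not yet occur above the row of
its new cell, which keeps the columns of the recording tableau strict. The second clause is this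
invariant, also used for injectivity. -/
theorem rsk_spec {w : List (ℕ × ℕ)} (hw : IsBiword w) : SameShape (rsk w) ∧
    ∀ p w', w = p :: w' → SameShape (rsk w') ∧ BoundedAt p.1 (insertionRow p.2 (rsk w').1) (rsk w').2 := by
  induction w with
  | nil => exact ⟨⟨trivial, trivial, rfl⟩, by simp⟩
  | cons p w ih =>
    rw [IsBiword, List.pairwise_cons] at hw
    obtain ⟨hs, hb⟩ := ih hw.2
    have key : BoundedAt p.1 (insertionRow p.2 (rsk w).1) (rsk w).2 := by
      cases w with
      | nil => simp [rsk, BoundedAt]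
      | cons q w =>
        obtain ⟨t, hq⟩ := hb q w rfl
        have hb₂ : BoundedAt q.1 (insertionRow q.2 (rsk w).1) (rsk (q :: w)).2 :=
          hq.append (t.insertionRow_le _)
        rcases hw.1 q (by simp) with h | ⟨h, h'⟩
        · exact ⟨fun r hr e he => (hb₂.1 r hr e he).trans h.le,
            fun r hr e he => (hb₂.1 r (List.mem_of_mem_take hr) e he).trans_lt h⟩
        · have hij := ((inserts_tableauInsert q.2 (rsk w).1).row_le_row_iff
            (inserts_tableauInsert p.2 _) t.1).2 h'
          rw [h] at hb₂
          exact ⟨hb₂.1, fun r hr => hb₂.2 r ((List.take_sublist_take_left hij).subset hr)⟩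
    refine ⟨⟨(inserts_tableauInsert _ _).isTableau hs.1, hs.2.1.append key ?_, ?_⟩, ?_⟩
    · rw [← hs.2.2, ← (inserts_tableauInsert _ _).map_length]
      exact ((inserts_tableauInsert _ _).isTableau hs.1).shape_pairwise
    · rw [rsk, (inserts_tableauInsert _ _).map_length, map_length_appendToRow, hs.2.2]
    · rintro p' w' h
      obtain ⟨rfl, rfl⟩ := List.cons.inj h
      exact ⟨hs, key⟩

theorem rsk_injOn : Set.InjOn rsk {w | IsBiword w} := by
  intro w hw w' hw' h
  rw [Set.mem_ofPred_eq] at hw hw'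
  induction w generalizing w' with
  | nil =>
    cases w' with
    | nil => rfl
    | cons p w' =>
      exact absurd (congrArg Prod.snd h).symm (appendToRow_ne_nil _ _ _)
  | cons p w ih =>
    cases w' with
    | nil => exact absurd (congrArg Prod.snd h) (appendToRow_ne_nil _ _ _)
    | cons q w' =>
      rw [rsk, rsk, Prod.mk.injEq] at h
      have s := rsk_spec hw
      have s' := rsk_spec hw'
      rw [IsBiword, List.pairwise_cons] at hw hw'
      have t := (rsk_spec hw.2).1
      have t' := (rsk_spec hw'.2).1
      obtain ⟨h1, h2, h3⟩ := appendToRow_boundedAt_injective t.2.1 t'.2.1 (s.2 _ _ rfl).2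
        (s'.2 _ _ rfl).2 (t.insertionRow_le _) (t'.insertionRow_le _) h.2
      obtain ⟨h4, h5⟩ := (inserts_tableauInsert p.2 (rsk w).1).unique
        (by rw [h.1, h2]; exact inserts_tableauInsert q.2 (rsk w').1) t.1 t'.1
      rw [Prod.ext h1 h4, ih hw.2 hw'.2 (Prod.ext h5 h3)]

theorem EndsInCorner.congr {i : ℕ} {T U : List (List ℕ)}
    (h : T.map List.length = U.map List.length) (hT : EndsInCorner i T) : EndsInCorner i U := by
  induction T generalizing i U with
  | nil => simp [EndsInCorner] at hT
  | cons r T ih =>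
    cases U with
    | nil => simp at h
    | cons q U =>
      simp only [List.map_cons, List.cons.injEq] at h
      cases i with
      | succ i => exact ih (i := i) h.2 hT
      | zero =>
        have : (T.headD []).length = (U.headD []).length := by
          have := congrArg (fun l => l.headD 0) h.2
          cases T <;> cases U <;> simp_all
        rw [EndsInCorner] at hT ⊢
        omega

/-- The cell to remove is the end of the topmost row containing the maximum `v`. All entries of the
next row are `≤ v`, so column strictness bounds its length by the number of entries `< v` in this
row; hence the cell is a corner. -/
theorem exists_eq_appendToRow {Q : List (List ℕ)} (hQ : IsTableau Q) {v : ℕ}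
    (hv : ∀ r ∈ Q, ∀ e ∈ r, e ≤ v) (hmem : ∃ r ∈ Q, v ∈ r) :
    ∃ i Q', IsTableau Q' ∧ Q = appendToRow i v Q' ∧ i ≤ Q'.length ∧ EndsInCorner i Q ∧
      BoundedAt v i Q' := by
  induction Q with
  | nil => simp at hmem
  | cons r Q ih =>
    obtain ⟨hne, hr, hd, hQ⟩ := hQ
    by_cases hvr : v ∈ r
    · have hhead : ∀ e ∈ Q.headD [], e ≤ v := by
        cases Q with
        | nil => simp
        | cons q Q => exact hv q (by simp)
      have hdv := hd v
      rw [countP_le_of_forall hhead] at hdv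
      have hlt : r.countP (· < v) < r.length := by
        refine lt_of_le_of_ne List.countP_le_length fun h => ?_
        simpa using List.countP_eq_length.1 h v hvr
      induction r using List.reverseRecOn with
      | nil => exact absurd rfl hne
      | append_singleton r z _ =>
        have hr' := List.pairwise_append.1 hr
        have hrz : ∀ e ∈ r, e ≤ z := by simpa using hr'.2.2
        obtain rfl : z = v := by
          refine le_antisymm (hv (r ++ [z]) (by simp) z (by simp)) ?_
          rcases List.mem_append.1 hvr with h | h
          · exact hrz v h
          · exact (List.mem_singleton.1 h).le
        by_cases hr0 : r = []
        · subst hr0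
          cases Q with
          | nil => exact ⟨0, [], trivial, rfl, le_rfl, by simp [EndsInCorner], by simp [BoundedAt]⟩
          | cons q Q => exact absurd (by simpa using hdv) hQ.1
        · refine ⟨0, r :: Q, ⟨hr0, hr'.1, fun c => ?_, hQ⟩, rfl, by simp, hdv.trans_lt hlt, ?_⟩
          · have hdc := hd c
            simp only [List.countP_append, List.countP_singleton, lt_self_iff_false,
              decide_false, decide_eq_true_eq] at hdc hdv
            rcases lt_or_ge z c with hc | hc
            · have := countP_lt_mono hc.le r
              have : (Q.headD []).countP (· ≤ c) ≤ _ := List.countP_le_length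
              simp only [Bool.false_eq_true, if_false, add_zero] at hdv
              omega
            · rwa [if_neg (by omega)] at hdc
          · refine ⟨fun q hq e he => ?_, by simp⟩
            rcases List.mem_cons.1 hq with rfl | hq
            · exact hrz e he
            · exact hv q (by simp [hq]) e he
    · obtain ⟨i, Q', h1, rfl, h3, h4, h5⟩ := ih hQ (fun q hq => hv q (by simp [hq])) (by
        obtain ⟨q, hq, hvq⟩ := hmem
        rcases List.mem_cons.1 hq with rfl | hq
        · exact absurd hvq hvr
        · exact ⟨q, hq, hvq⟩)
      have hrv : ∀ e ∈ r, e < v := fun e he =>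
        lt_of_le_of_ne (hv r (by simp) e he) fun h => hvr (h ▸ he)
      refine ⟨i + 1, r :: Q', ⟨hne, hr, fun c => le_trans ?_ (hd c), h1⟩, rfl, by simpa using h3,
        h4, ?_, ?_⟩
      · cases Q' <;> cases i <;> simp [appendToRow]
      · simpa using ⟨fun e he => (hrv e he).le, h5.1⟩
      · simpa using ⟨hrv, h5.2⟩

theorem rsk_surjOn : Set.SurjOn rsk {w | IsBiword w} {p | SameShape p} := by
  rintro ⟨P, Q⟩ h
  simp only [Set.mem_ofPred_eq] at h
  induction hn : Q.flatten.length generalizing P Q with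
  | zero =>
    cases Q with
    | nil =>
      obtain rfl : P = [] := by simpa using h.2.2
      exact ⟨[], by simp [IsBiword], rfl⟩
    | cons r Q => exact absurd (by simpa using hn) fun h' : r = [] ∧ _ => h.2.1.1 h'.1
  | succ n ih =>
    obtain ⟨v, hv, hmax⟩ : ∃ v ∈ Q.flatten, ∀ e ∈ Q.flatten, e ≤ v := by
      obtain ⟨v, hv, hmax⟩ := Finset.exists_max_image Q.flatten.toFinset id (by
        rw [List.toFinset_nonempty_iff]
        rintro h
        simp [h] at hn)
      exact ⟨v, by simpa using hv, fun e he => hmax e (by simpa using he)⟩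
    obtain ⟨i, Q, hQ, rfl, hi, hc, hb⟩ := exists_eq_appendToRow h.2.1
      (fun r hr e he => hmax e (List.mem_flatten.2 ⟨r, hr, he⟩)) (List.mem_flatten.1 hv)
    obtain ⟨a, P, hP, hins⟩ := exists_inserts h.1 (hc.congr h.2.2.symm)
    have hPQ : SameShape (P, Q) := by
      refine ⟨hP, hQ, addCell_injective (i := i) ?_ ?_ ?_⟩
      · simpa using hP.ne_nil
      · simpa using hQ.ne_nil
      · rw [← hins.map_length, ← map_length_appendToRow i v]
        exact h.2.2
    obtain ⟨w, hw, hrsk⟩ := ih P Q hPQ (by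
      rw [(flatten_appendToRow_perm i v Q).length_eq] at hn
      simpa using hn)
    simp only [Set.mem_ofPred_eq] at hw
    refine ⟨(v, a) :: w, ?_, ?_⟩
    -- The order on equal recorded values is recovered from the other direction of the row bumping
    -- lemma: the removed cell lies weakly above the previous one, so the letters increase weakly.
    · have key : ∀ q w', w = q :: w' → q.1 < v ∨ q.1 = v ∧ q.2 ≤ a := by
        rintro q w rfl
        have t := (rsk_spec (List.pairwise_cons.1 hw).2).1
        have hj := t.insertionRow_le q.2
        rw [rsk, Prod.mk.injEq] at hrsk
        obtain ⟨r, hr, hq⟩ := exists_mem_take_appendToRow (v := q.1) hj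
        rw [hrsk.2] at hr
        refine (hb.1 r (List.mem_of_mem_take hr) q.1 hq).lt_or_eq.imp_right fun hqv => ⟨hqv, ?_⟩
        rw [← (inserts_tableauInsert q.2 (rsk w).1).row_le_row_iff (hrsk.1 ▸ hins) t.1]
        exact hb.row_le (hqv ▸ hrsk.2.symm) hj
      rw [Set.mem_ofPred_eq, IsBiword, List.pairwise_cons]
      refine ⟨fun x hx => ?_, hw⟩
      cases w with
      | nil => simp at hx
      | cons q w =>
        have hq := key q w rfl
        rcases List.mem_cons.1 hx with rfl | hx
        · exact hq
        · have := (List.pairwise_cons.1 hw).1 x hx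
          simp only
          omega
    · simp [rsk, hrsk, hins.eq.1, hins.eq.2]

theorem flatten_rsk_fst_perm (w : List (ℕ × ℕ)) : (rsk w).1.flatten.Perm (w.map Prod.snd) := by
  induction w with
  | nil => exact .refl _
  | cons p w ih => exact (inserts_tableauInsert _ _).flatten_perm.trans (ih.cons _)

theorem flatten_rsk_snd_perm (w : List (ℕ × ℕ)) : (rsk w).2.flatten.Perm (w.map Prod.fst) := by
  induction w with
  | nil => exact .refl _
  | cons p w ih => exact (flatten_appendToRow_perm _ _ _).trans (ih.cons _)

theorem rsk_fst (w : List (ℕ × ℕ)) : (rsk w).1 = insertionTableau (w.reverse.map Prod.snd) := by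
  induction w with
  | nil => rfl
  | cons p w ih =>
    rw [List.reverse_cons, List.map_append, List.map_singleton, insertionTableau_append_singleton,
      rsk, ih]

/-! ### Lists of rows versus semistandard fillings of a Young diagram. -/

theorem dominates_iff {r s : List ℕ} (hr : r.Pairwise (· ≤ ·)) (hs : s.Pairwise (· ≤ ·)) :
    Dominates r s ↔ s.length ≤ r.length ∧ ∀ j < s.length, r.getD j 0 < s.getD j 0 := by
  induction s generalizing r with
  | nil => simp [Dominates]
  | cons b s ih =>
    rw [List.pairwise_cons] at hs
    cases r with
    | nil =>
      simp only [List.length_nil, List.length_cons]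
      refine ⟨fun h => ?_, by omega⟩
      simpa using h b
    | cons a r =>
      rw [List.pairwise_cons] at hr
      have key : Dominates (a :: r) (b :: s) ↔ a < b ∧ Dominates r s := by
        have hb : ∀ c, b ≤ c → (b :: s).countP (· ≤ c) = s.countP (· ≤ c) + 1 := fun c hc => by
          rw [List.countP_cons_of_pos (by simpa using hc)]
        have hb' : ∀ c, c < b → s.countP (· ≤ c) = 0 := fun c hc =>
          countP_le_eq_zero fun e he => hc.trans_le (hs.1 e he)
        constructor
        · intro h
          have hab : a < b := by
            by_contra hab
            have := h b
            rw [hb b le_rfl, countP_lt_eq_zero] at this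
            · omega
            · intro e he
              rcases List.mem_cons.1 he with rfl | he
              · omega
              · have := hr.1 e he
                omega
          refine ⟨hab, fun c => ?_⟩
          rcases le_or_gt b c with hc | hc
          · have := h c
            rw [hb c hc, List.countP_cons_of_pos (by simp; omega)] at this
            omega
          · rw [hb' c hc]
            exact Nat.zero_le _
        · rintro ⟨hab, h⟩ c
          rcases le_or_gt b c with hc | hc
          · rw [hb c hc, List.countP_cons_of_pos (by simp; omega)]
            exact Nat.succ_le_succ (h c)
          · rw [List.countP_cons_of_neg (by simp; omega), hb' c hc]
            exact Nat.zero_le _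
      rw [key, ih hr.2 hs.2]
      simp only [List.length_cons, Nat.forall_lt_succ_left, List.getD_cons_zero, List.getD_cons_succ,
        Nat.add_le_add_iff_right]
      tauto

theorem isTableau_iff {Q : List (List ℕ)} : IsTableau Q ↔ (∀ r ∈ Q, r ≠ []) ∧
    (∀ i, (Q.getD i []).Pairwise (· ≤ ·)) ∧ ∀ i, Dominates (Q.getD i []) (Q.getD (i + 1) []) := by
  induction Q with
  | nil => simp [IsTableau, Dominates]
  | cons r Q ih =>
    have hz : Q.getD 0 [] = Q.headD [] := by cases Q <;> rfl
    rw [IsTableau, ih, List.forall_mem_cons, ← hz]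
    constructor
    · rintro ⟨h1, h2, h3, h4, h5, h6⟩
      refine ⟨⟨h1, h4⟩, fun i => ?_, fun i => ?_⟩ <;> cases i
      exacts [h2, h5 _, h3, h6 _]
    · rintro ⟨⟨h1, h2⟩, h3, h4⟩
      exact ⟨h1, h3 0, h4 0, h2, fun i => h3 (i + 1), fun i => h4 (i + 1)⟩

namespace SemistandardYoungTableau

variable {μ : YoungDiagram}

/-- The list of rows of a semistandard tableau. -/
def rows (T : SemistandardYoungTableau μ) : List (List ℕ) :=
  (List.range (μ.colLen 0)).map fun i => (List.range (μ.rowLen i)).map (T i)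

theorem lt_colLen_zero_iff {i : ℕ} : i < μ.colLen 0 ↔ 0 < μ.rowLen i := by
  rw [← YoungDiagram.mem_iff_lt_colLen, YoungDiagram.mem_iff_lt_rowLen]

theorem getD_rows (T : SemistandardYoungTableau μ) (i : ℕ) :
    T.rows.getD i [] = (List.range (μ.rowLen i)).map (T i) := by
  by_cases hi : i < μ.colLen 0
  · rw [List.getD_eq_getElem _ _ (by simpa [rows] using hi)]
    simp [rows]
  · rw [List.getD_eq_default _ _ (by simpa [rows] using hi)]
    rw [lt_colLen_zero_iff, Nat.pos_iff_ne_zero, not_not] at hi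
    simp [hi]

theorem getD_getD_rows (T : SemistandardYoungTableau μ) (i j : ℕ) :
    (T.rows.getD i []).getD j 0 = T i j := by
  rw [getD_rows]
  by_cases hj : j < μ.rowLen i
  · rw [List.getD_eq_getElem _ _ (by simpa using hj)]
    simp
  · rw [List.getD_eq_default _ _ (by simpa using hj),
      T.zeros (by rwa [YoungDiagram.mem_iff_lt_rowLen])]

theorem map_length_rows (T : SemistandardYoungTableau μ) : T.rows.map List.length = μ.rowLens := by
  rw [rows, List.map_map, YoungDiagram.rowLens]
  congr 1
  ext i
  simp

theorem rows_injective : Function.Injective (rows (μ := μ)) := by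
  intro T T' h
  ext i j
  rw [← getD_getD_rows, h, getD_getD_rows]

theorem row_pairwise (T : SemistandardYoungTableau μ) (i : ℕ) :
    ((List.range (μ.rowLen i)).map (T i)).Pairwise (· ≤ ·) := by
  rw [List.pairwise_iff_getElem]
  intro j k hj hk hjk
  simpa using T.row_weak hjk (YoungDiagram.mem_iff_lt_rowLen.2 (by simpa using hk))

theorem isTableau_rows (T : SemistandardYoungTableau μ) : IsTableau T.rows := by
  refine isTableau_iff.2 ⟨fun r hr => ?_, fun i => ?_, fun i => ?_⟩
  · simp only [rows, List.mem_map, List.mem_range] at hr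
    obtain ⟨i, hi, rfl⟩ := hr
    rw [lt_colLen_zero_iff] at hi
    simp
    omega
  · rw [getD_rows]
    exact T.row_pairwise i
  · rw [getD_rows, getD_rows, dominates_iff (T.row_pairwise i) (T.row_pairwise _), ← getD_rows,
      ← getD_rows]
    simp only [getD_getD_rows]
    simp only [getD_rows, List.length_map, List.length_range]
    refine ⟨μ.rowLen_anti _ _ (Nat.le_succ i), fun j hj => ?_⟩
    exact T.col_strict (Nat.lt_succ_self i) (YoungDiagram.mem_iff_lt_rowLen.2 hj)

theorem exists_rows_eq {Q : List (List ℕ)} (hQ : IsTableau Q)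
    (hs : Q.map List.length = μ.rowLens) : ∃ T : SemistandardYoungTableau μ, T.rows = Q := by
  have hlen : ∀ i, (Q.getD i []).length = μ.rowLen i := by
    intro i
    have h1 : Q.length = μ.colLen 0 := by
      simpa [YoungDiagram.length_rowLens] using congrArg List.length hs
    by_cases hi : i < μ.colLen 0
    · have h2 : (Q.map List.length)[i]'(by simp; omega) = μ.rowLens[i]'(by
        rw [YoungDiagram.length_rowLens]; exact hi) := by simp only [hs]
      rw [List.getD_eq_getElem _ _ (by omega)]
      simpa [YoungDiagram.rowLens] using h2
    · rw [List.getD_eq_default _ _ (by omega)]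
      rw [lt_colLen_zero_iff] at hi
      simp
      omega
  obtain ⟨-, hr, hd⟩ := isTableau_iff.1 hQ
  have hd' := fun i => (dominates_iff (hr i) (hr (i + 1))).1 (hd i)
  simp only [hlen] at hd'
  let T : SemistandardYoungTableau μ :=
    { entry := fun i j => (Q.getD i []).getD j 0
      row_weak' := by
        intro i j₁ j₂ hj hmem
        rw [YoungDiagram.mem_iff_lt_rowLen, ← hlen] at hmem
        rw [List.getD_eq_getElem _ _ (hj.trans hmem), List.getD_eq_getElem _ _ hmem]
        exact List.pairwise_iff_getElem.1 (hr i) _ _ _ _ hj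
      col_strict' := by
        intro i₁ i₂ j hi hmem
        induction i₂, hi using Nat.le_induction with
        | base => exact (hd' i₁).2 j (YoungDiagram.mem_iff_lt_rowLen.1 hmem)
        | succ k hk ih =>
          exact (ih (μ.up_left_mem (Nat.le_succ k) le_rfl hmem)).trans
            ((hd' k).2 j (YoungDiagram.mem_iff_lt_rowLen.1 hmem))
      zeros' := by
        intro i j hmem
        rw [YoungDiagram.mem_iff_lt_rowLen, ← hlen, not_lt] at hmem
        exact List.getD_eq_default _ _ hmem }
  refine ⟨T, List.ext_getElem ?_ fun i h₁ h₂ => ?_⟩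
  · rw [← List.length_map (f := List.length), map_length_rows, ← hs, List.length_map]
  · rw [← List.getD_eq_getElem _ [] h₁, ← List.getD_eq_getElem _ [] h₂, getD_rows]
    refine List.ext_getElem (by rw [hlen]; simp) fun j k₁ k₂ => ?_
    rw [← List.getD_eq_getElem _ 0 k₂]
    simp only [List.getElem_map, List.getElem_range]
    rfl

theorem count_flatten_rows (T : SemistandardYoungTableau μ) (k : ℕ) :
    T.rows.flatten.count k = (μ.cells.filter fun c => T c.1 c.2 = k).card := by
  rw [Finset.card_eq_sum_card_fiberwise (f := Prod.fst) (t := Finset.range (μ.colLen 0)),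
    List.count_flatten, rows, List.map_map, ← List.sum_toFinset _ List.nodup_range,
    List.toFinset_range]
  · refine Finset.sum_congr rfl fun i _ => ?_
    rw [Function.comp, List.count, List.countP_map, List.countP_eq_length_filter,
      ← List.toFinset_card_of_nodup (List.nodup_range.filter _)]
    refine Finset.card_bij' (fun j _ => (i, j)) (fun c _ => c.2) ?_ ?_ ?_ ?_
    · intro j hj
      simp_all [YoungDiagram.mem_cells, YoungDiagram.mem_iff_lt_rowLen]
    · rintro ⟨i', j⟩ hj
      simp only [Finset.mem_filter, YoungDiagram.mem_cells, YoungDiagram.mem_iff_lt_rowLen] at hj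
      obtain ⟨⟨h1, h2⟩, rfl⟩ := hj
      simp [h1, h2]
    · simp
    · rintro ⟨i', j⟩ hj
      simp at hj
      simp [hj.2]
  · rintro ⟨i, j⟩ hc
    simp only [Finset.coe_filter, Set.mem_ofPred_eq, YoungDiagram.mem_cells] at hc
    simpa [lt_colLen_zero_iff] using
      (YoungDiagram.mem_iff_lt_rowLen.1 hc.1).trans_le' (Nat.zero_le j)

/-- Semistandard tableaux as lists of rows, with prescribed content. -/
noncomputable def rowsEquiv (μ : YoungDiagram) (m : ℕ → ℕ) :
    {T : SemistandardYoungTableau μ //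
      ∀ k, (μ.cells.filter fun c => T c.1 c.2 = k).card = m k} ≃
    {Q : List (List ℕ) // IsTableau Q ∧ Q.map List.length = μ.rowLens ∧
      ∀ k, Q.flatten.count k = m k} :=
  Equiv.ofBijective (fun T => ⟨T.1.rows, T.1.isTableau_rows, T.1.map_length_rows, fun k => by
      rw [count_flatten_rows, T.2 k]⟩) <| by
    refine ⟨fun T T' h => Subtype.ext (rows_injective (congrArg Subtype.val h)), ?_⟩
    rintro ⟨Q, h1, h2, h3⟩
    obtain ⟨T, rfl⟩ := exists_rows_eq h1 h2
    exact ⟨⟨T, fun k => by rw [← count_flatten_rows, h3 k]⟩, rfl⟩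

end SemistandardYoungTableau

/-! ### Standard tableaux as semistandard tableaux of standard content. -/

/-- The multiplicities of the multiset `{1, …, n}`. -/
def standardContent (n k : ℕ) : ℕ := if 1 ≤ k ∧ k ≤ n then 1 else 0

namespace StandardTableau

variable {μ : YoungDiagram}

/-- A standard tableau as a semistandard one with entries `1, …, n`. -/
def toSemistandard (τ : StandardTableau μ) : SemistandardYoungTableau μ where
  entry i j := if h : (i, j) ∈ μ.cells then τ.1 ⟨(i, j), h⟩ + 1 else 0
  row_weak' := by
    intro i j₁ j₂ hj hmem
    rw [dif_pos ((YoungDiagram.mem_cells _).2 (μ.up_left_mem le_rfl hj.le hmem)),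
      dif_pos ((YoungDiagram.mem_cells _).2 hmem)]
    exact Nat.succ_le_succ (τ.2.1 ⟨(i, j₁), _⟩ ⟨(i, j₂), _⟩ rfl hj).le
  col_strict' := by
    intro i₁ i₂ j hi hmem
    rw [dif_pos ((YoungDiagram.mem_cells _).2 (μ.up_left_mem hi.le le_rfl hmem)),
      dif_pos ((YoungDiagram.mem_cells _).2 hmem)]
    exact Nat.succ_lt_succ (τ.2.2 ⟨(i₁, j), _⟩ ⟨(i₂, j), _⟩ rfl hi)
  zeros' := by
    intro i j hmem
    exact dif_neg hmem

theorem toSemistandard_apply (τ : StandardTableau μ) (c : μ.cells) :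
    τ.toSemistandard c.1.1 c.1.2 = τ.1 c + 1 :=
  dif_pos c.2

theorem card_filter_toSemistandard (τ : StandardTableau μ) (k : ℕ) :
    (μ.cells.filter fun c => τ.toSemistandard c.1 c.2 = k).card = standardContent μ.card k := by
  rw [standardContent]
  split_ifs with hk
  · rw [Finset.card_eq_one]
    refine ⟨(τ.1.symm ⟨k - 1, by omega⟩).1, ?_⟩
    ext c
    rw [Finset.mem_filter, Finset.mem_singleton]
    constructor
    · rintro ⟨hc, h⟩
      have := τ.toSemistandard_apply ⟨c, hc⟩
      rw [h] at this
      have h2 : τ.1 ⟨c, hc⟩ = ⟨k - 1, by omega⟩ := Fin.ext (by simp [this])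
      rw [← h2, Equiv.symm_apply_apply]
    · rintro rfl
      refine ⟨Subtype.prop _, ?_⟩
      rw [toSemistandard_apply, Equiv.apply_symm_apply]
      simp only
      omega
  · rw [Finset.card_eq_zero, Finset.filter_eq_empty_iff]
    rintro c hc rfl
    have := τ.toSemistandard_apply ⟨c, hc⟩
    have := (τ.1 ⟨c, hc⟩).2
    simp only at *
    omega

theorem exists_toSemistandard_eq {T : SemistandardYoungTableau μ}
    (hT : ∀ k, (μ.cells.filter fun c => T c.1 c.2 = k).card = standardContent μ.card k) :
    ∃ τ : StandardTableau μ, τ.toSemistandard = T := by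
  have hrange : ∀ c ∈ μ.cells, 1 ≤ T c.1 c.2 ∧ T c.1 c.2 ≤ μ.card := by
    intro c hc
    by_contra h
    have := hT (T c.1 c.2)
    rw [standardContent, if_neg h, Finset.card_eq_zero, Finset.filter_eq_empty_iff] at this
    exact this hc rfl
  have hinj : ∀ c ∈ μ.cells, ∀ d ∈ μ.cells, T c.1 c.2 = T d.1 d.2 → c = d := by
    intro c hc d hd h
    have h1 : (μ.cells.filter fun e => T e.1 e.2 = T d.1 d.2).card ≤ 1 := by
      rw [hT, standardContent]
      split_ifs <;> omega
    exact Finset.card_le_one.1 h1 c (by simp [hc, h]) d (by simp [hd])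
  let f : μ.cells → Fin μ.card := fun c =>
    ⟨T c.1.1 c.1.2 - 1, by have := hrange c.1 c.2; omega⟩
  have hf : Function.Injective f := by
    intro c d h
    have h1 := hrange c.1 c.2
    have h2 := hrange d.1 d.2
    have h3 : T c.1.1 c.1.2 - 1 = T d.1.1 d.1.2 - 1 := congrArg Fin.val h
    exact Subtype.ext (hinj _ c.2 _ d.2 (by omega))
  have hbij : Function.Bijective f := by
    rw [Fintype.bijective_iff_injective_and_card]
    exact ⟨hf, by simp [YoungDiagram.card]⟩
  have hlt : ∀ c d : μ.cells, T c.1.1 c.1.2 < T d.1.1 d.1.2 → f c < f d := by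
    intro c d h
    have h1 := hrange c.1 c.2
    exact Fin.lt_def.2 (show T c.1.1 c.1.2 - 1 < T d.1.1 d.1.2 - 1 by omega)
  refine ⟨⟨Equiv.ofBijective f hbij, ?_, ?_⟩, ?_⟩
  · rintro ⟨⟨i, j⟩, hc⟩ ⟨⟨i', j'⟩, hd⟩ h h'
    simp only at h h'
    subst h
    refine hlt _ _ (lt_of_le_of_ne (T.row_weak h' hd) fun h => ?_)
    have := hinj _ hc _ hd h
    simp at this
    omega
  · rintro ⟨⟨i, j⟩, hc⟩ ⟨⟨i', j'⟩, hd⟩ h h'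
    simp only at h h'
    subst h
    exact hlt _ _ (T.col_strict h' hd)
  · ext i j
    by_cases h : (i, j) ∈ μ.cells
    · refine (toSemistandard_apply _ ⟨(i, j), h⟩).trans ?_
      have := hrange (i, j) h
      change T i j - 1 + 1 = T i j
      simp only at this
      omega
    · rw [T.zeros h, SemistandardYoungTableau.zeros _ h]

theorem toSemistandard_injective : Function.Injective (toSemistandard (μ := μ)) := by
  intro τ τ' h
  refine Subtype.ext (Equiv.ext fun c => Fin.ext ?_)
  have h1 := τ.toSemistandard_apply c
  rw [h, toSemistandard_apply] at h1
  omega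

/-- Standard tableaux are the semistandard tableaux of standard content. -/
noncomputable def equivSemistandard (μ : YoungDiagram) : StandardTableau μ ≃
    {T : SemistandardYoungTableau μ //
      ∀ k, (μ.cells.filter fun c => T c.1 c.2 = k).card = standardContent μ.card k} :=
  Equiv.ofBijective (fun τ => ⟨τ.toSemistandard, τ.card_filter_toSemistandard⟩) <| by
    refine ⟨fun τ τ' h => toSemistandard_injective (congrArg Subtype.val h), ?_⟩
    rintro ⟨T, hT⟩
    obtain ⟨τ, rfl⟩ := exists_toSemistandard_eq hT
    exact ⟨τ, rfl⟩

end StandardTableau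

/-! ### The generating function of a shape class. -/

theorem list_count_ofFn_eq {n : ℕ} (x : Fin n → ℕ) (k : ℕ) :
    (List.ofFn x).count k = (∑ i, Finsupp.single (x i) 1 : ℕ →₀ ℕ) k := by
  have key : ∀ l : List ℕ, l.count k = (l.map fun y => Finsupp.single y 1 : List (ℕ →₀ ℕ)).sum k := by
    intro l
    induction l with
    | nil => rfl
    | cons y l ih =>
      rw [List.count_cons, List.map_cons, List.sum_cons, Finsupp.add_apply, ← ih,
        Finsupp.single_apply, add_comm]
      simp
  rw [key, List.map_ofFn, List.sum_ofFn]
  rfl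

theorem count_ofFn_perm {n : ℕ} (σ : Equiv.Perm (Fin n)) (k : ℕ) :
    (List.ofFn fun i => (σ i : ℕ) + 1).count k = standardContent n k := by
  have hnd : (List.ofFn fun i => (σ i : ℕ) + 1).Nodup :=
    List.nodup_ofFn.2 fun i j h => σ.injective (Fin.ext (Nat.succ.inj h))
  rw [standardContent]
  split_ifs with h
  · refine List.count_eq_one_of_mem hnd ((List.mem_ofFn' _ _).2 ⟨σ.symm ⟨k - 1, by omega⟩, ?_⟩)
    simp
    omega
  · refine List.count_eq_zero.2 fun hk => h ?_
    obtain ⟨i, rfl⟩ := (List.mem_ofFn' _ _).1 hk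
    have := (σ i).2
    simp only
    omega

/-- The two-line array with upper row `x` and lower row `σ`, in reverse order. -/
def biword {n : ℕ} (σ : Equiv.Perm (Fin n)) (x : Fin n → ℕ) : List (ℕ × ℕ) :=
  (List.ofFn fun i => (x i, (σ i : ℕ) + 1)).reverse

theorem map_fst_biword {n : ℕ} (σ : Equiv.Perm (Fin n)) (x : Fin n → ℕ) :
    (biword σ x).map Prod.fst = (List.ofFn x).reverse := by
  rw [biword, List.map_reverse, List.map_ofFn]
  rfl

theorem map_snd_biword {n : ℕ} (σ : Equiv.Perm (Fin n)) (x : Fin n → ℕ) :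
    (biword σ x).map Prod.snd = (List.ofFn fun i => (σ i : ℕ) + 1).reverse := by
  rw [biword, List.map_reverse, List.map_ofFn]
  rfl

theorem rsk_biword_fst {n : ℕ} (σ : Equiv.Perm (Fin n)) (x : Fin n → ℕ) :
    (rsk (biword σ x)).1 = pTableau σ := by
  rw [rsk_fst, List.map_reverse, map_snd_biword, List.reverse_reverse]
  rfl

theorem biword_injective {n : ℕ} {σ σ' : Equiv.Perm (Fin n)} {x x' : Fin n → ℕ}
    (h : biword σ x = biword σ' x') : σ = σ' ∧ x = x' := by
  have h' := List.ofFn_injective (List.reverse_injective h)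
  refine ⟨Equiv.ext fun i => Fin.ext ?_, funext fun i => ?_⟩
  · exact Nat.succ.inj (congrArg Prod.snd (congrFun h' i))
  · exact congrArg Prod.fst (congrFun h' i)

/-- Lexicographic order is transitive, so it need only be tested on adjacent columns. There it asks
for a weak increase of `x`, strict wherever `σ` descends, which is the condition in
`fundamentalQSym`. -/
theorem isBiword_biword_iff {n : ℕ} {σ : Equiv.Perm (Fin n)} {x : Fin n → ℕ} :
    IsBiword (biword σ x) ↔ Monotone x ∧
      ∀ (i : ℕ) (h : i + 1 < n), i + 1 ∈ descentSet σ →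
        x ⟨i, Nat.lt_of_succ_lt h⟩ < x ⟨i + 1, h⟩ := by
  rw [IsBiword, biword, List.pairwise_reverse, List.pairwise_ofFn]
  simp only [Nat.add_le_add_iff_right]
  constructor
  · intro H
    refine ⟨fun i j hij => ?_, fun i h hd => ?_⟩
    · rcases hij.eq_or_lt with rfl | hij
      · exact le_rfl
      · rcases H hij with h | h
        exacts [h.le, h.1.le]
    · obtain ⟨i', h', he, hd⟩ := hd
      obtain rfl : i = i' := by omega
      rcases H (show (⟨i, Nat.lt_of_succ_lt h⟩ : Fin n) < ⟨i + 1, h⟩ from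
        Fin.lt_def.2 (Nat.lt_succ_self i)) with h₂ | h₂
      · exact h₂
      · exact absurd (Fin.lt_def.1 hd) (not_lt.2 h₂.2)
  · rintro ⟨hm, hs⟩ ⟨i, hi⟩ ⟨j, hj⟩ hij
    replace hij : i + 1 ≤ j := hij
    have step : ∀ k (h : k + 1 < n), x ⟨k, Nat.lt_of_succ_lt h⟩ < x ⟨k + 1, h⟩ ∨
        x ⟨k, Nat.lt_of_succ_lt h⟩ = x ⟨k + 1, h⟩ ∧
          (σ ⟨k, Nat.lt_of_succ_lt h⟩ : ℕ) ≤ σ ⟨k + 1, h⟩ := by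
      intro k h
      by_cases hd : k + 1 ∈ descentSet σ
      · exact Or.inl (hs k h hd)
      · refine (hm (show (⟨k, Nat.lt_of_succ_lt h⟩ : Fin n) ≤ ⟨k + 1, h⟩ from
          Fin.le_def.2 (Nat.le_succ k))).lt_or_eq.imp_right fun he => ⟨he, ?_⟩
        by_contra hlt
        exact hd ⟨k, h, rfl, Fin.lt_def.2 (not_le.1 hlt)⟩
    induction j, hij using Nat.le_induction with
    | base => exact step i hj
    | succ k hk ih =>
      have h1 := ih (Nat.lt_of_succ_lt hj)
      have h2 := step k hj
      omega

theorem exists_biword_eq {n : ℕ} {w : List (ℕ × ℕ)}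
    (hw : ∀ k, (w.map Prod.snd).count k = standardContent n k) :
    ∃ (σ : Equiv.Perm (Fin n)) (x : Fin n → ℕ), biword σ x = w := by
  obtain ⟨u, rfl⟩ : ∃ u : List (ℕ × ℕ), w = u.reverse := ⟨w.reverse, by simp⟩
  have hperm : (u.map Prod.snd).Perm (List.ofFn fun i : Fin n => (i : ℕ) + 1) := by
    rw [List.perm_iff_count]
    intro k
    rw [← List.count_reverse, ← List.map_reverse, hw]
    exact (count_ofFn_perm (1 : Equiv.Perm (Fin n)) k).symm
  have hnd : (u.map Prod.snd).Nodup := hperm.nodup_iff.2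
    (List.nodup_ofFn.2 fun i j h => Fin.ext (Nat.succ.inj h))
  have hmem : ∀ p ∈ u, 1 ≤ p.2 ∧ p.2 ≤ n := by
    intro p hp
    have := hperm.mem_iff.1 (List.mem_map_of_mem (f := Prod.snd) hp)
    obtain ⟨i, hi⟩ := (List.mem_ofFn' _ _).1 this
    have := i.2
    simp only at hi
    omega
  obtain rfl : u.length = n := by simpa using hperm.length_eq
  let f : Fin u.length → Fin u.length := fun i =>
    ⟨(u[i]).2 - 1, by have := hmem _ (List.getElem_mem i.2); simp only [Fin.getElem_fin]; omega⟩
  have hval : ∀ i : Fin u.length, (f i : ℕ) + 1 = (u[i]).2 := fun i => by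
    have := hmem _ (List.getElem_mem i.2)
    simp only [f, Fin.getElem_fin]
    omega
  have hf : Function.Injective f := by
    intro i j h
    have h' : (u[i]).2 = (u[j]).2 := by rw [← hval, ← hval, h]
    refine Fin.ext ((List.Nodup.getElem_inj_iff hnd (hi := by simp) (hj := by simp)).1 ?_)
    simpa using h'
  refine ⟨Equiv.ofBijective f (Finite.injective_iff_bijective.1 hf), fun i => (u[i]).1, ?_⟩
  rw [biword]
  congr 1
  refine List.ext_getElem (by simp) fun i h₁ h₂ => ?_
  rw [List.getElem_ofFn]
  exact Prod.ext rfl (hval _)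

theorem finite_sequences {n : ℕ} (p : (Fin n → ℕ) → Prop) (m : ℕ →₀ ℕ)
    (hp : ∀ x, p x → ∑ i, Finsupp.single (x i) 1 = m) : Finite {x // p x} := by
  refine Finite.of_injective (β := Fin n → m.support)
    (fun x i => ⟨x.1 i, ?_⟩) fun x y h => Subtype.ext (funext fun i => ?_)
  · rw [Finsupp.mem_support_iff, ← hp x.1 x.2, ← list_count_ofFn_eq, ← Nat.pos_iff_ne_zero,
      List.count_pos_iff]
    exact (List.mem_ofFn' _ _).2 ⟨i, rfl⟩
  · exact congrArg Subtype.val (congrFun h i)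

/-- RSK restricted to arrays whose lower row is a permutation: `P` has standard content and is
counted by `numSYT`, while `Q` has content `m` and is counted by the Schur coefficient. -/
theorem sum_card_eq_numSYT_mul {n : ℕ} {lam : YoungDiagram} (hlam : lam.card = n) (m : ℕ →₀ ℕ) :
    ∑ σ : Equiv.Perm (Fin n) with (pTableau σ).map List.length = lam.rowLens,
      Nat.card {x : Fin n → ℕ // Monotone x ∧
        (∀ (i : ℕ) (h : i + 1 < n), i + 1 ∈ descentSet σ →
          x ⟨i, Nat.lt_of_succ_lt h⟩ < x ⟨i + 1, h⟩) ∧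
        ∑ i, Finsupp.single (x i) 1 = m} =
    numSYT lam * Nat.card {T : SemistandardYoungTableau lam //
      ∀ k : ℕ, (lam.cells.filter fun c => T c.1 c.2 = k).card = m k} := by
  subst hlam
  -- Finiteness of the fibres, needed by `Nat.card_sigma`.
  have hfin := fun σ : Equiv.Perm (Fin lam.card) => finite_sequences (fun x => Monotone x ∧
        (∀ (i : ℕ) (h : i + 1 < lam.card), i + 1 ∈ descentSet σ →
          x ⟨i, Nat.lt_of_succ_lt h⟩ < x ⟨i + 1, h⟩) ∧
        ∑ i, Finsupp.single (x i) 1 = m) m fun x hx => hx.2.2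
  rw [numSYT, Nat.card_congr ((StandardTableau.equivSemistandard lam).trans
      (SemistandardYoungTableau.rowsEquiv lam _)),
    Nat.card_congr (SemistandardYoungTableau.rowsEquiv lam m), ← Nat.card_prod,
    Finset.sum_subtype (p := fun σ => (pTableau σ).map List.length = lam.rowLens) _ (by simp),
    ← Nat.card_sigma]
  have hspec := fun (σ : Equiv.Perm (Fin lam.card)) (x : Fin lam.card → ℕ)
    (hx : IsBiword (biword σ x)) => (rsk_spec hx).1
  refine Nat.card_congr (Equiv.ofBijective (fun q =>
    (⟨(rsk (biword q.1.1 q.2.1)).1, ?_, ?_, fun k => ?_⟩,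
      ⟨(rsk (biword q.1.1 q.2.1)).2, ?_, ?_, fun k => ?_⟩)) ⟨?_, ?_⟩)
  · exact (hspec _ _ (isBiword_biword_iff.2 ⟨q.2.2.1, q.2.2.2.1⟩)).1
  · rw [rsk_biword_fst]
    exact q.1.2
  · rw [(flatten_rsk_fst_perm _).count_eq, map_snd_biword, List.count_reverse, count_ofFn_perm]
  · exact (hspec _ _ (isBiword_biword_iff.2 ⟨q.2.2.1, q.2.2.2.1⟩)).2.1
  · rw [← (hspec _ _ (isBiword_biword_iff.2 ⟨q.2.2.1, q.2.2.2.1⟩)).2.2, rsk_biword_fst]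
    exact q.1.2
  · rw [(flatten_rsk_snd_perm _).count_eq, map_fst_biword, List.count_reverse, list_count_ofFn_eq,
      q.2.2.2.2]
  · rintro ⟨⟨σ, hσ⟩, x, hx⟩ ⟨⟨σ', hσ'⟩, x', hx'⟩ h
    rw [Prod.mk.injEq, Subtype.mk.injEq, Subtype.mk.injEq] at h
    obtain ⟨rfl, rfl⟩ := biword_injective (rsk_injOn (isBiword_biword_iff.2 ⟨hx.1, hx.2.1⟩)
      (isBiword_biword_iff.2 ⟨hx'.1, hx'.2.1⟩) (Prod.ext h.1 h.2))
    rfl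
  · rintro ⟨⟨P, hP, hPs, hPc⟩, ⟨Q, hQ, hQs, hQc⟩⟩
    obtain ⟨w, hw, hPQ⟩ := rsk_surjOn (show SameShape (P, Q) from ⟨hP, hQ, hPs.trans hQs.symm⟩)
    rw [Set.mem_ofPred_eq] at hw
    -- Since `P` has standard content, the lower row of the preimage is a rearrangement of `1, …,
    -- n`.
    obtain ⟨σ, x, rfl⟩ := exists_biword_eq (n := lam.card) (w := w) fun k => by
      rw [← (flatten_rsk_fst_perm w).count_eq, hPQ, hPc]
    have hb := isBiword_biword_iff.1 hw
    refine ⟨⟨⟨σ, ?_⟩, x, hb.1, hb.2, ?_⟩, ?_⟩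
    · rw [← rsk_biword_fst σ x, hPQ]
      exact hPs
    · ext k
      rw [← list_count_ofFn_eq, ← hQc, ← List.count_reverse, ← map_fst_biword σ,
        ← (flatten_rsk_snd_perm _).count_eq, hPQ]
    · simp [hPQ]

/-! ### Schensted's theorem for permutations. -/

/-- Sublists of a word that are `R`-chains correspond to sets of positions carrying an `R`-chain. -/
theorem exists_sublist_ofFn_iff {n k : ℕ} {R : ℕ → ℕ → Prop} (g : Fin n → ℕ) :
    (∃ α : List ℕ, α.Sublist (List.ofFn g) ∧ α.Pairwise R ∧ α.length = k) ↔
      ∃ S : Finset (Fin n), S.card = k ∧ ∀ i ∈ S, ∀ j ∈ S, i < j → R (g i) (g j) := by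
  constructor
  · rintro ⟨α, hα, hp, rfl⟩
    obtain ⟨f, hf⟩ := List.sublist_iff_exists_fin_orderEmbedding_get_eq.1 hα
    let f' : Fin α.length ↪o Fin n := f.trans (Fin.castOrderIso (by simp)).toOrderEmbedding
    have hf' : ∀ i, α.get i = g (f' i) := fun i => by rw [hf i, List.get_ofFn]; rfl
    refine ⟨Finset.univ.map f'.toEmbedding, by simp, ?_⟩
    simp only [Finset.mem_map, Finset.mem_univ, true_and]
    rintro _ ⟨i, rfl⟩ _ ⟨j, rfl⟩ hij
    have := List.pairwise_iff_get.1 hp i j (f'.lt_iff_lt.1 hij)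
    rwa [hf', hf'] at this
  · rintro ⟨S, rfl, hS⟩
    refine ⟨List.ofFn fun i => g (S.orderEmbOfFin rfl i), ?_, ?_, by simp⟩
    · refine List.sublist_iff_exists_fin_orderEmbedding_get_eq.2
        ⟨((Fin.castOrderIso (by simp)).toOrderEmbedding.trans (S.orderEmbOfFin rfl)).trans
          (Fin.castOrderIso (by simp)).toOrderEmbedding, fun i => ?_⟩
      rw [List.get_ofFn, List.get_ofFn]
      rfl
    · rw [List.pairwise_ofFn]
      intro i j hij
      exact hS _ (S.orderEmbOfFin_mem rfl i) _ (S.orderEmbOfFin_mem rfl j)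
        ((S.orderEmbOfFin rfl).lt_iff_lt.2 hij)

/-- Schensted's theorem on increasing subsequences of a permutation. -/
theorem le_length_head_pTableau {n k : ℕ} {σ : Equiv.Perm (Fin n)} :
    k ≤ ((pTableau σ).headD []).length ↔
      ∃ S : Finset (Fin n), S.card = k ∧ StrictMonoOn σ S := by
  refine (le_length_head_insertionTableau.trans (exists_sublist_ofFn_iff _)).trans
    (exists_congr fun S => and_congr_right fun _ => ?_)
  refine ⟨fun h i hi j hj hij => ?_, fun h i hi j hj hij => ?_⟩
  · refine lt_of_le_of_ne ?_ (σ.injective.ne hij.ne)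
    simpa using h i hi j hj hij
  · simpa using (h hi hj hij).le

/-- Schensted's theorem on decreasing subsequences of a permutation. -/
theorem le_length_pTableau {n k : ℕ} {σ : Equiv.Perm (Fin n)} :
    k ≤ (pTableau σ).length ↔ ∃ S : Finset (Fin n), S.card = k ∧ StrictAntiOn σ S := by
  refine (le_length_insertionTableau.trans (exists_sublist_ofFn_iff _)).trans
    (exists_congr fun S => and_congr_right fun _ => ?_)
  refine ⟨fun h i hi j hj hij => ?_, fun h i hi j hj hij => ?_⟩
  · simpa using h i hi j hj hij
  · simpa using h hi hj hij

theorem isTableau_pTableau {n : ℕ} (σ : Equiv.Perm (Fin n)) : IsTableau (pTableau σ) :=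
  isTableau_insertionTableau _

theorem sum_length_pTableau {n : ℕ} (σ : Equiv.Perm (Fin n)) :
    ((pTableau σ).map List.length).sum = n := by
  rw [← List.length_flatten]
  exact (flatten_insertionTableau_perm _).length_eq.trans (by simp)

/-! ### Hooks and patterns. -/

/-- The first row of the shape of `σ` has at least `a` cells, and its first column more
than `b`. -/
def HasHook {n : ℕ} (a b : ℕ) (σ : Equiv.Perm (Fin n)) : Prop :=
  a ≤ ((pTableau σ).headD []).length ∧ b + 1 ≤ (pTableau σ).length

theorem ContainsPattern.trans {n k l : ℕ} {σ : Equiv.Perm (Fin n)} {π : Equiv.Perm (Fin k)}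
    {ρ : Equiv.Perm (Fin l)} (h : ContainsPattern σ π) (h' : ContainsPattern π ρ) :
    ContainsPattern σ ρ := by
  obtain ⟨f, hf⟩ := h
  obtain ⟨g, hg⟩ := h'
  exact ⟨g.trans f, fun i j => (hf _ _).trans (hg i j)⟩

theorem HasHook.of_containsPattern {n k a b : ℕ} {σ : Equiv.Perm (Fin n)}
    {π : Equiv.Perm (Fin k)} (h : HasHook a b π) (hc : ContainsPattern σ π) : HasHook a b σ := by
  obtain ⟨f, hf⟩ := hc
  rw [HasHook, le_length_head_pTableau, le_length_pTableau] at h ⊢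
  obtain ⟨⟨I, hI, hI'⟩, D, hD, hD'⟩ := h
  refine ⟨⟨I.map f.toEmbedding, by simpa, ?_⟩, D.map f.toEmbedding, by simpa, ?_⟩
  · rw [Finset.coe_map]
    rintro _ ⟨i, hi, rfl⟩ _ ⟨j, hj, rfl⟩ hij
    exact (hf i j).2 (hI' hi hj (f.lt_iff_lt.1 hij))
  · rw [Finset.coe_map]
    rintro _ ⟨i, hi, rfl⟩ _ ⟨j, hj, rfl⟩ hij
    exact (hf j i).2 (hD' hi hj (f.lt_iff_lt.1 hij))

theorem exists_perm_lt_iff {n k : ℕ} {g : Fin k → Fin n} (hg : Function.Injective g) :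
    ∃ π : Equiv.Perm (Fin k), ∀ i j, g i < g j ↔ π i < π j := by
  have hV : (Finset.univ.image g).card = k := by
    rw [Finset.card_image_of_injective _ hg, Finset.card_univ, Fintype.card_fin]
  let e := (Finset.univ.image g).orderIsoOfFin hV
  let p : Fin k → Fin k := fun i => e.symm ⟨g i, by simp⟩
  have hp : ∀ i j, g i < g j ↔ p i < p j := fun i j => by
    rw [e.symm.lt_iff_lt, Subtype.mk_lt_mk]
  have hinj : Function.Injective p := fun i j h => by
    have h1 := (hp i j).not.2 h.not_lt
    have h2 := (hp j i).not.2 h.not_gt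
    exact hg (le_antisymm (not_lt.1 h2) (not_lt.1 h1))
  exact ⟨Equiv.ofBijective p (Finite.injective_iff_bijective.1 hinj), hp⟩

/-- The pattern of `σ` on a set `U` of positions inherits the monotone subsequences in `U`. -/
theorem exists_pattern_on {n k a b : ℕ} (σ : Equiv.Perm (Fin n)) {U I D : Finset (Fin n)}
    (hU : U.card = k) (hIU : I ⊆ U) (hDU : D ⊆ U) (hIc : I.card = a) (hDc : D.card = b + 1)
    (hI : StrictMonoOn σ I) (hD : StrictAntiOn σ D) :
    ∃ π : Equiv.Perm (Fin k), ContainsPattern σ π ∧ HasHook a b π := by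
  set f := U.orderEmbOfFin hU with hf
  obtain ⟨π, hπ⟩ := exists_perm_lt_iff (g := σ ∘ f) (σ.injective.comp f.injective)
  have hcard : ∀ S ⊆ U, (Finset.univ.filter fun i => f i ∈ S).card = S.card := by
    intro S hS
    rw [← Finset.card_map f.toEmbedding]
    congr 1
    ext x
    simp only [Finset.mem_map, Finset.mem_filter, Finset.mem_univ, true_and]
    constructor
    · rintro ⟨i, hi, rfl⟩
      exact hi
    · intro hx
      obtain ⟨i, rfl⟩ : x ∈ Set.range f := by
        rw [hf, Finset.range_orderEmbOfFin]
        exact hS hx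
      exact ⟨i, hx, rfl⟩
  refine ⟨π, ⟨f, hπ⟩, ?_⟩
  rw [HasHook, le_length_head_pTableau, le_length_pTableau]
  refine ⟨⟨_, (hcard I hIU).trans hIc, fun i hi j hj hij => ?_⟩,
    ⟨_, (hcard D hDU).trans hDc, fun i hi j hj hij => ?_⟩⟩
  · simp only [Finset.coe_filter, Finset.mem_univ, true_and, Set.mem_ofPred_eq] at hi hj
    exact (hπ i j).1 (hI hi hj (f.lt_iff_lt.2 hij))
  · simp only [Finset.coe_filter, Finset.mem_univ, true_and, Set.mem_ofPred_eq] at hi hj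
    exact (hπ j i).1 (hD hi hj (f.lt_iff_lt.2 hij))

theorem inter_subsingleton {n : ℕ} {σ : Equiv.Perm (Fin n)} {I D : Finset (Fin n)}
    (hI : StrictMonoOn σ I) (hD : StrictAntiOn σ D) {x y : Fin n} (hx : x ∈ I ∩ D)
    (hy : y ∈ I ∩ D) : x = y := by
  rw [Finset.mem_inter] at hx hy
  rcases lt_trichotomy x y with h | h | h
  · exact absurd (hI hx.1 hy.1 h) (hD hx.2 hy.2 h).not_gt
  · exact h
  · exact absurd (hI hy.1 hx.1 h) (hD hy.2 hx.2 h).not_gt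

/-- The two subsequences share exactly one position, so their union has `a + (b + 1) - 1` positions.
-/
theorem exists_pattern_of_inter {n a b : ℕ} (σ : Equiv.Perm (Fin n)) {I D : Finset (Fin n)}
    (hIc : I.card = a) (hDc : D.card = b + 1) (hI : StrictMonoOn σ I) (hD : StrictAntiOn σ D)
    {x : Fin n} (hx : x ∈ I ∩ D) :
    ∃ π : Equiv.Perm (Fin (a + b)), ContainsPattern σ π ∧ HasHook a b π := by
  have h1 : (I ∩ D).card = 1 :=
    Finset.card_eq_one.2 ⟨x, Finset.eq_singleton_iff_unique_mem.2
      ⟨hx, fun y hy => inter_subsingleton hI hD hy hx⟩⟩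
  have h2 := Finset.card_union_add_card_inter I D
  exact exists_pattern_on σ (U := I ∪ D) (by omega) Finset.subset_union_left
    Finset.subset_union_right hIc hDc hI hD

theorem HasHook.exists_pattern {n a b : ℕ} (ha : 2 ≤ a) {σ : Equiv.Perm (Fin n)}
    (h : HasHook a b σ) :
    (∃ π : Equiv.Perm (Fin (a + b)), ContainsPattern σ π ∧ HasHook a b π) ∨
    ∃ π : Equiv.Perm (Fin (a + b + 1)), ContainsPattern σ π ∧
      ((pTableau π).headD []).length = a ∧ (pTableau π).length = b + 1 := by
  rw [HasHook, le_length_head_pTableau, le_length_pTableau] at h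
  obtain ⟨⟨I, hIc, hI⟩, D, hDc, hD⟩ := h
  by_cases hID : (I ∩ D).Nonempty
  · obtain ⟨x, hx⟩ := hID
    exact Or.inl (exists_pattern_of_inter σ hIc hDc hI hD hx)
  have h2 := Finset.card_union_add_card_inter I D
  rw [Finset.not_nonempty_iff_eq_empty.1 hID, Finset.card_empty] at h2
  obtain ⟨π, hc, h⟩ := exists_pattern_on σ (U := I ∪ D) (k := a + b + 1) (by omega)
    Finset.subset_union_left Finset.subset_union_right hIc hDc hI hD
  -- From here on everything happens inside `π`, whose size `a + b + 1` leaves no room for disjoint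
  -- subsequences once either is longer than required.
  clear hIc hDc hI hD hID h2
  have inter : ∀ I D : Finset (Fin (a + b + 1)), a + b + 1 < I.card + D.card →
      ∃ x, x ∈ I ∩ D := by
    intro I D hcard
    by_contra hne
    push Not at hne
    have h2 := Finset.card_union_add_card_inter I D
    rw [Finset.eq_empty_of_forall_notMem hne, Finset.card_empty] at h2
    have := Finset.card_le_univ (I ∪ D)
    rw [Fintype.card_fin] at this
    omega
  by_cases h1 : a + 1 ≤ ((pTableau π).headD []).length
  · left
    obtain ⟨D, hDc, hD⟩ := le_length_pTableau.1 h.2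
    obtain ⟨I, hIc, hI⟩ := le_length_head_pTableau.1 h1
    obtain ⟨x, hx⟩ := inter I D (by omega)
    have hx' := Finset.mem_inter.1 hx
    -- The increasing subsequence is one too long; a position other than the common one is dropped,
    -- so the two still meet.
    obtain ⟨y, hy, hyx⟩ := Finset.exists_mem_ne (s := I) (by omega) x
    obtain ⟨ρ, hρ, hh⟩ := exists_pattern_of_inter (a := a) π (I := I.erase y)
      (by rw [Finset.card_erase_of_mem hy]; omega) hDc (hI.mono (by simp)) hD
      (Finset.mem_inter.2 ⟨Finset.mem_erase.2 ⟨hyx.symm, hx'.1⟩, hx'.2⟩)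
    exact ⟨ρ, hc.trans hρ, hh⟩
  by_cases h2 : b + 1 + 1 ≤ (pTableau π).length
  · left
    obtain ⟨D, hDc, hD⟩ := le_length_pTableau.1 h2
    obtain ⟨I, hIc, hI⟩ := le_length_head_pTableau.1 h.1
    obtain ⟨x, hx⟩ := inter I D (by omega)
    have hx' := Finset.mem_inter.1 hx
    obtain ⟨y, hy, hyx⟩ := Finset.exists_mem_ne (s := D) (by omega) x
    obtain ⟨ρ, hρ, hh⟩ := exists_pattern_of_inter (b := b) π (D := D.erase y) hIc
      (by rw [Finset.card_erase_of_mem hy]; omega) hI (hD.mono (by simp))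
      (Finset.mem_inter.2 ⟨hx'.1, Finset.mem_erase.2 ⟨hyx.symm, hx'.2⟩⟩)
    exact ⟨ρ, hc.trans hρ, hh⟩
  · have := h.1
    have := h.2
    exact Or.inr ⟨π, hc, by omega, by omega⟩

/-! ### Identifying the two forbidden shapes. -/

theorem length_le_sum_of_pos {t : List ℕ} (h : ∀ k ∈ t, 0 < k) : t.length ≤ t.sum := by
  induction t with
  | nil => simp
  | cons k t ih =>
    rw [List.forall_mem_cons] at h
    have := ih h.2
    simp
    omega

theorem eq_replicate_of_sum_eq_length {t : List ℕ} (h : ∀ k ∈ t, 0 < k)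
    (hs : t.sum = t.length) : t = List.replicate t.length 1 := by
  induction t with
  | nil => simp
  | cons k t ih =>
    rw [List.forall_mem_cons] at h
    have := length_le_sum_of_pos h.2
    rw [List.sum_cons, List.length_cons] at hs
    rw [List.length_cons, List.replicate_succ, ← ih h.2 (by omega), show k = 1 by omega]

theorem IsTableau.shape_pos {T : List (List ℕ)} (h : IsTableau T) :
    ∀ k ∈ T.map List.length, 0 < k := by
  simpa [List.length_pos_iff] using h.ne_nil

/-- A first part of at least `a` and at least `b` further positive parts already use up the total `a
+ b`, so all the inequalities are equalities. -/
theorem eq_hook_of_sum {K : List ℕ} {a b : ℕ} (hpos : ∀ k ∈ K, 0 < k) (hsum : K.sum = a + b)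
    (ha : a ≤ K.headD 0) (hb : b + 1 ≤ K.length) : K = a :: List.replicate b 1 := by
  cases K with
  | nil => simp at hb
  | cons h t =>
    rw [List.forall_mem_cons] at hpos
    have h1 := length_le_sum_of_pos hpos.2
    simp only [List.sum_cons, List.headD_cons, List.length_cons] at hsum ha hb
    have h2 := eq_replicate_of_sum_eq_length hpos.2 (by omega)
    rw [h2, show h = a by omega, show t.length = b by omega]

/-- The `b` parts after the first sum to `b + 1`. The one surplus cell must lie in the largest of
them, which is the second part of the partition. -/
theorem eq_nearHook_of_sum {K : List ℕ} {a b : ℕ} (hb1 : 1 ≤ b) (hpos : ∀ k ∈ K, 0 < k)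
    (hK : K.Pairwise (· ≥ ·)) (hsum : K.sum = a + b + 1) (ha : K.headD 0 = a)
    (hb : K.length = b + 1) : K = a :: 2 :: List.replicate (b - 1) 1 := by
  match K with
  | [] => simp at hb
  | [h] => simp at hb; omega
  | h :: k :: t =>
    rw [List.forall_mem_cons, List.forall_mem_cons] at hpos
    rw [List.pairwise_cons, List.pairwise_cons] at hK
    have h1 := length_le_sum_of_pos hpos.2.2
    simp only [List.sum_cons, List.headD_cons, List.length_cons] at hsum ha hb
    have hk : k = 2 := by
      by_contra hk
      have : k = 1 := by omega
      have h2 : t.sum ≤ t.length • 1 := List.sum_le_card_nsmul _ _ fun x hx => by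
        have := hK.2.1 x hx
        omega
      simp at h2
      omega
    have h2 := eq_replicate_of_sum_eq_length hpos.2.2 (by omega)
    rw [h2, hk, ha, show t.length = b - 1 by omega]

theorem rowLens_hookShape {a b : ℕ} (ha : 2 ≤ a) :
    (hookShape a b ha).rowLens = a :: List.replicate b 1 :=
  YoungDiagram.rowLens_ofRowLens_eq_self fun x hx => by
    rcases List.mem_cons.1 hx with rfl | hx
    · omega
    · simp [List.eq_of_mem_replicate hx]

theorem rowLens_nearHookShape {a b : ℕ} (ha : 2 ≤ a) :
    (nearHookShape a b ha).rowLens = a :: 2 :: List.replicate (b - 1) 1 :=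
  YoungDiagram.rowLens_ofRowLens_eq_self fun x hx => by
    rcases List.mem_cons.1 hx with rfl | hx
    · omega
    · rcases List.mem_cons.1 hx with rfl | hx
      · omega
      · simp [List.eq_of_mem_replicate hx]

theorem headD_map_length (T : List (List ℕ)) :
    (T.map List.length).headD 0 = (T.headD []).length := by
  cases T <;> rfl

theorem mem_avoiders_iff {n a b : ℕ} (ha : 2 ≤ a) (hb : 1 ≤ b) {σ : Equiv.Perm (Fin n)} :
    σ ∈ avoiders n (shapeClass (hookShape a b ha) ∪ shapeClass (nearHookShape a b ha)) ↔
      ¬ HasHook a b σ := by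
  constructor
  · intro h hσ
    rcases hσ.exists_pattern ha with ⟨π, hc, hπ⟩ | ⟨π, hc, h1, h2⟩
    · refine h ⟨_, π⟩ (Or.inl ?_) hc
      rw [shapeClass, Set.mem_ofPred_eq, rowLens_hookShape]
      exact eq_hook_of_sum (isTableau_pTableau π).shape_pos (sum_length_pTableau π)
        (by rw [headD_map_length]; exact hπ.1) (by rw [List.length_map]; exact hπ.2)
    · refine h ⟨_, π⟩ (Or.inr ?_) hc
      rw [shapeClass, Set.mem_ofPred_eq, rowLens_nearHookShape]
      exact eq_nearHook_of_sum hb (isTableau_pTableau π).shape_pos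
        (isTableau_pTableau π).shape_pairwise (sum_length_pTableau π)
        (by rw [headD_map_length, h1]) (by rw [List.length_map, h2])
  · rintro h ⟨k, π⟩ hπ hc
    refine h (HasHook.of_containsPattern ?_ hc)
    rw [HasHook, ← headD_map_length, ← List.length_map (f := List.length)]
    rcases hπ with hπ | hπ <;> rw [shapeClass, Set.mem_ofPred_eq] at hπ <;> simp only at hπ
    · rw [hπ, rowLens_hookShape]
      simp
    · rw [hπ, rowLens_nearHookShape]
      simp
      omega

theorem hookShape_le_iff {a b : ℕ} (ha : 2 ≤ a) {lam : YoungDiagram} :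
    hookShape a b ha ≤ lam ↔ a ≤ lam.rowLen 0 ∧ b + 1 ≤ lam.colLen 0 := by
  have hmem : ∀ i j, (i, j) ∈ hookShape a b ha ↔ (i = 0 ∧ j < a) ∨ (i ≤ b ∧ j = 0) := by
    intro i j
    rw [hookShape, YoungDiagram.mem_ofRowLens]
    cases i with
    | zero => simp; omega
    | succ i => simp
  constructor
  · intro h
    have h1 : (0, a - 1) ∈ lam := h ((hmem _ _).2 (Or.inl ⟨rfl, by omega⟩))
    have h2 : (b, 0) ∈ lam := h ((hmem _ _).2 (Or.inr ⟨le_rfl, rfl⟩))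
    rw [YoungDiagram.mem_iff_lt_rowLen] at h1
    rw [YoungDiagram.mem_iff_lt_colLen] at h2
    omega
  · rintro ⟨h1, h2⟩ ⟨i, j⟩ h
    rcases (hmem i j).1 h with ⟨rfl, hj⟩ | ⟨hi, rfl⟩
    · exact YoungDiagram.mem_iff_lt_rowLen.2 (hj.trans_le h1)
    · exact YoungDiagram.mem_iff_lt_colLen.2 (by omega)

/-! ### Shapes of permutations and the conclusion. -/

/-- The shape of `P(σ)` as a Young diagram. -/
def shapeOf {n : ℕ} (σ : Equiv.Perm (Fin n)) : YoungDiagram :=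
  YoungDiagram.ofRowLens ((pTableau σ).map List.length)
    (List.sortedGE_iff_pairwise.2 (isTableau_pTableau σ).shape_pairwise)

theorem rowLens_shapeOf {n : ℕ} (σ : Equiv.Perm (Fin n)) :
    (shapeOf σ).rowLens = (pTableau σ).map List.length :=
  YoungDiagram.rowLens_ofRowLens_eq_self (isTableau_pTableau σ).shape_pos

theorem sum_rowLens (lam : YoungDiagram) : lam.rowLens.sum = lam.card := by
  rw [YoungDiagram.card,
    Finset.card_eq_sum_card_fiberwise (f := Prod.fst) (t := Finset.range (lam.colLen 0)),
    YoungDiagram.rowLens, ← List.sum_toFinset _ List.nodup_range, List.toFinset_range]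
  · exact Finset.sum_congr rfl fun i _ => lam.rowLen_eq_card
  · rintro ⟨i, j⟩ hc
    rw [Finset.mem_coe, YoungDiagram.mem_cells] at hc
    simpa [YoungDiagram.mem_iff_lt_colLen] using lam.up_left_mem le_rfl (Nat.zero_le j) hc

theorem card_shapeOf {n : ℕ} (σ : Equiv.Perm (Fin n)) : (shapeOf σ).card = n := by
  rw [← sum_rowLens, rowLens_shapeOf, sum_length_pTableau]

theorem shapeOf_eq_iff {n : ℕ} {σ : Equiv.Perm (Fin n)} {lam : YoungDiagram} :
    shapeOf σ = lam ↔ (pTableau σ).map List.length = lam.rowLens := by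
  rw [← rowLens_shapeOf]
  refine ⟨congrArg _, fun h => ?_⟩
  have h1 := YoungDiagram.ofRowLens_to_rowLens_eq_self (μ := shapeOf σ)
  have h2 := YoungDiagram.ofRowLens_to_rowLens_eq_self (μ := lam)
  rw [← h1, ← h2]
  simp only [h]

theorem hookShape_le_shapeOf_iff {n a b : ℕ} (ha : 2 ≤ a) {σ : Equiv.Perm (Fin n)} :
    hookShape a b ha ≤ shapeOf σ ↔ HasHook a b σ := by
  have h1 : (shapeOf σ).rowLen 0 = ((pTableau σ).headD []).length := by
    rw [← headD_map_length, ← rowLens_shapeOf, YoungDiagram.rowLens]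
    cases h : (shapeOf σ).colLen 0 with
    | zero =>
      have : ¬ 0 < (shapeOf σ).rowLen 0 := by
        rw [← SemistandardYoungTableau.lt_colLen_zero_iff]
        omega
      simp
      omega
    | succ k => simp [List.range_succ_eq_map]
  have h2 : (shapeOf σ).colLen 0 = (pTableau σ).length := by
    rw [← YoungDiagram.length_rowLens, rowLens_shapeOf, List.length_map]
  rw [hookShape_le_iff, h1, h2, HasHook]

theorem mainTheorem8 (a b : ℕ) (ha : 2 ≤ a) (hb : 1 ≤ b) :
    IsPatternKnuthClosed (shapeClass (hookShape a b ha) ∪ shapeClass (nearHookShape a b ha)) ∧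
    ∀ n : ℕ,
      patternQSym n (shapeClass (hookShape a b ha) ∪ shapeClass (nearHookShape a b ha)) =
        ∑ lam ∈ shapesAvoiding n (hookShape a b ha), (numSYT lam : ℝ) • schurFunction lam := by
  classical
  constructor
  · intro k
    -- Avoidance reads only the first row and the number of rows of `P`. Lists that are not
    -- insertion tableaux of size `k` do no harm, as their Knuth classes are empty.
    refine ⟨{P | ¬ (a ≤ (P.headD []).length ∧ b + 1 ≤ P.length)}, ?_⟩
    ext σ
    rw [mem_avoiders_iff ha hb]
    simp only [Set.mem_iUnion, knuthClass, Set.mem_ofPred_eq, exists_prop, exists_eq_right']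
    rfl
  · intro n
    have hmaps : ∀ σ ∈ Finset.univ.filter (fun σ : Equiv.Perm (Fin n) => σ ∈ avoiders n
        (shapeClass (hookShape a b ha) ∪ shapeClass (nearHookShape a b ha))),
        shapeOf σ ∈ shapesAvoiding n (hookShape a b ha) := by
      intro σ hσ
      rw [Finset.mem_filter, mem_avoiders_iff ha hb] at hσ
      rw [shapesAvoiding, Finset.mem_filter, hookShape_le_shapeOf_iff, partitionsOf,
        Set.Finite.mem_toFinset]
      exact ⟨card_shapeOf σ, hσ.2⟩
    rw [patternQSym]
    -- The `congr` only reconciles decidability instances; the sum is then split according to the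
    -- shape of `σ`.
    refine Eq.trans (Finset.sum_congr (by congr) fun _ _ => rfl)
      ((Finset.sum_fiberwise_of_maps_to hmaps _).symm.trans ?_)
    refine Finset.sum_congr rfl fun lam hlam => ?_
    rw [shapesAvoiding, Finset.mem_filter, partitionsOf, Set.Finite.mem_toFinset] at hlam
    -- For a shape not containing the hook, every permutation of that shape is an avoider, so the
    -- fibre is the whole shape class.
    have hfilter : ((Finset.univ.filter (fun σ : Equiv.Perm (Fin n) => σ ∈ avoiders n
        (shapeClass (hookShape a b ha) ∪ shapeClass (nearHookShape a b ha)))).filter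
        fun σ => shapeOf σ = lam) =
        Finset.univ.filter fun σ => (pTableau σ).map List.length = lam.rowLens := by
      ext σ
      simp only [Finset.mem_filter, Finset.mem_univ, true_and]
      rw [mem_avoiders_iff ha hb, ← hookShape_le_shapeOf_iff ha, ← shapeOf_eq_iff]
      exact ⟨fun h => h.2, fun h => ⟨h ▸ hlam.2, h⟩⟩
    rw [hfilter]
    ext m
    rw [map_sum, map_smul, smul_eq_mul]
    have := sum_card_eq_numSYT_mul (n := n) hlam.1 m
    have := congrArg (Nat.cast (R := ℝ)) this
    rw [Nat.cast_sum, Nat.cast_mul] at this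
    exact this
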